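/- Let $n\ge 1$ and $K_0\in[1,\infty)$. For a non-negative locally integrable $\omega:\mathbb R^n\to\mathbb R$ that is positive almost everywhere, write $\omega\in A_{1+1/n}$ if $$[\omega]_{A_{1+1/n}}=\sup_{B}\Big(\frac1{|B|}\int_B\omega\,dx\Big)\Big(\frac1{|B|}\int_B\omega^{-n}dx\Big)^{1/n}<\infty ,$$ the supremum being over all balls $B\subset\mathbb R^n$. For measurable $A\subset\mathbb R^n\times\mathbb R$ put $\omega(A)=\int_A\omega(x)\,dx\,dt$. For $\rho>0$ and $X=(x,s)\in\mathbb R^n\times\mathbb R$ let $h_\rho(x)=\rho^2\big(\frac1{|B_\rho(x)|}\int_{B_\rho(x)}\omega^{-n}dz\big)^{1/n}$ and $$C_{\rho,\omega}(X)=B_\rho(x)\times(s-h_\rho(x),\,s),\qquad C_{\rho,\omega}=C_{\rho,\omega}(0,0).$$ For $\eta\in(0,1)$ and $l>1$ associate with $C=C_{\rho,\omega}(X)$ the sets $$\tilde C=B_{\eta\rho}(x)\times(s-h_\rho(x),\,s),\qquad \hat C=B_{\eta\rho}(x)\times(s+h_\rho(x),\,s+l\,h_\rho(x)).$$ There are constants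 $N>0$ and $\lambda_0>0$, depending only on $n$ and $K_0$, such that the following holds for every $\omega\in A_{1+1/n}$ with $[\omega]_{A_{1+1/n}}\le K_0$, every $r>0$, every measurable $\Gamma\subset C_{r,\omega}$, and all $q,\eta\in(0,1)$, $l>1$. Put $$\xi_0=1+\frac{1-q-N(1-\eta^n)^{\lambda_0}}{3^{n+2}K_0},\qquad \xi_1=\frac{l-1}{l+1}.$$ (a) Let $\mathcal A$ be the family of all cylinders $C=C_{\rho,\omega}(X)$, $\rho>0$, $X\in\mathbb R^n\times\mathbb R$, with $\omega(C\cap\Gamma)\ge q\,\omega(C)$, and let $\tilde E=\bigcup_{C\in\mathcal A}\tilde C$, $\hat E=\bigcup_{C\in\mathcal A}\hat C$. Then $$\omega(\Gamma\setminus\tilde E)=0,\qquad \omega(\tilde E)\ge\xi_0\,\omega(\Gamma),\qquad \omega(\hat E)\ge\xi_1\,\omega(\tilde E).$$ (b) Let $\mathcal A'$ consist of those $C\in\mathcal A$ with $C\subset C_{r,\omega}$, and let $\tilde E'=\bigcup_{C\in\mathcal A'}\tilde C$, $\hat E'=\bigcup_{C\in\mathcal A'}\hat C$. Then $$\omega(\Gamma\setminus\tilde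 E')=0,\qquad \omega(\hat E')\ge\xi_1\,\omega(\tilde E'),$$ and, if $\omega(\Gamma)\le q\,\omega(C_{r,\omega})$, also $\omega(\tilde E')\ge\xi_0\,\omega(\Gamma)$. -/

import Mathlib

open MeasureTheory Set
open scoped ENNReal

noncomputable section

namespace WeightedCovering

/-- The `A_p` constant `[μ]_{A_p}` of a function `μ` on `ℝⁿ`: the supremum over all balls `B` of
`(⨍_B μ) (⨍_B μ ^ (-1/(p-1))) ^ (p-1)`, with values in `[0, ∞]`. -/
def apConst {n : ℕ} (p : ℝ) (μ : EuclideanSpace ℝ (Fin n) → ℝ) : ℝ≥0∞ :=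
  ⨆ (x₀ : EuclideanSpace ℝ (Fin n)) (r : ℝ) (_ : 0 < r),
    ((∫⁻ x in Metric.ball x₀ r, ENNReal.ofReal (μ x)) / volume (Metric.ball x₀ r)) *
      ((∫⁻ x in Metric.ball x₀ r, ENNReal.ofReal (μ x) ^ (-(1 / (p - 1)))) /
        volume (Metric.ball x₀ r)) ^ (p - 1)

/-- The Muckenhoupt class `A_p`: non-negative locally integrable functions with finite `A_p`
constant. The condition that `μ` is positive almost everywhere only excludes `μ = 0` a.e.,
for which the product in the `A_p` constant is the indeterminate `0 * ∞`. -/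
structure IsAp {n : ℕ} (p : ℝ) (μ : EuclideanSpace ℝ (Fin n) → ℝ) : Prop where
  nonneg : ∀ x, 0 ≤ μ x
  locallyIntegrable : LocallyIntegrable μ volume
  ae_pos : ∀ᵐ x, 0 < μ x
  apConst_lt_top : apConst p μ < ∞

/-- The weighted measure `ω(A) = ∫_A ω(x) dx dt` on space-time `ℝⁿ × ℝ`. -/
def wMeasure {n : ℕ} (ω : EuclideanSpace ℝ (Fin n) → ℝ) :
    Measure (EuclideanSpace ℝ (Fin n) × ℝ) :=
  volume.withDensity fun X => ENNReal.ofReal (ω X.1)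

/-- The time length `ρ² ((ω⁻ⁿ)_{B_ρ(x)})^{1/n}` of the weighted cylinder over `B_ρ(x)`. -/
def height {n : ℕ} (ω : EuclideanSpace ℝ (Fin n) → ℝ) (ρ : ℝ) (x : EuclideanSpace ℝ (Fin n)) : ℝ :=
  ρ ^ 2 * (⨍ z in Metric.ball x ρ, (ω z ^ n)⁻¹) ^ (1 / (n : ℝ))

/-- The weighted parabolic cylinder `C_{ρ,ω}(X)`, `X = (x, s)`. -/
def cyl {n : ℕ} (ω : EuclideanSpace ℝ (Fin n) → ℝ) (ρ : ℝ) (X : EuclideanSpace ℝ (Fin n) × ℝ) :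
    Set (EuclideanSpace ℝ (Fin n) × ℝ) :=
  Metric.ball X.1 ρ ×ˢ Ioo (X.2 - height ω ρ X.1) X.2

/-- The cylinder shrunk in space by the factor `η`. -/
def cylTilde {n : ℕ} (ω : EuclideanSpace ℝ (Fin n) → ℝ) (η ρ : ℝ)
    (X : EuclideanSpace ℝ (Fin n) × ℝ) : Set (EuclideanSpace ℝ (Fin n) × ℝ) :=
  Metric.ball X.1 (η * ρ) ×ˢ Ioo (X.2 - height ω ρ X.1) X.2

/-- The cylinder shrunk in space by the factor `η` and shifted forward in time. -/
def cylHat {n : ℕ} (ω : EuclideanSpace ℝ (Fin n) → ℝ) (η l ρ : ℝ)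
    (X : EuclideanSpace ℝ (Fin n) × ℝ) : Set (EuclideanSpace ℝ (Fin n) × ℝ) :=
  Metric.ball X.1 (η * ρ) ×ˢ
    Ioo (X.2 + height ω ρ X.1) (X.2 + l * height ω ρ X.1)

/-- The weighted cylinders contained in `U` in which `Γ` has `ω`-density at least `q`, each
recorded by its radius and centre. -/
def family {n : ℕ} (ω : EuclideanSpace ℝ (Fin n) → ℝ)
    (U Γ : Set (EuclideanSpace ℝ (Fin n) × ℝ)) (q : ℝ) :
    Set (ℝ × (EuclideanSpace ℝ (Fin n) × ℝ)) :=
  {c | 0 < c.1 ∧ cyl ω c.1 c.2 ⊆ U ∧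
    ENNReal.ofReal q * wMeasure ω (cyl ω c.1 c.2) ≤ wMeasure ω (cyl ω c.1 c.2 ∩ Γ)}

/-- The union of the shrunken cylinders of the family. -/
def setTilde {n : ℕ} (ω : EuclideanSpace ℝ (Fin n) → ℝ)
    (U Γ : Set (EuclideanSpace ℝ (Fin n) × ℝ)) (q η : ℝ) :
    Set (EuclideanSpace ℝ (Fin n) × ℝ) :=
  ⋃ c ∈ family ω U Γ q, cylTilde ω η c.1 c.2

/-- The union of the shrunken and time-shifted cylinders of the family. -/
def setHat {n : ℕ} (ω : EuclideanSpace ℝ (Fin n) → ℝ)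
    (U Γ : Set (EuclideanSpace ℝ (Fin n) × ℝ)) (q η l : ℝ) :
    Set (EuclideanSpace ℝ (Fin n) × ℝ) :=
  ⋃ c ∈ family ω U Γ q, cylHat ω η l c.1 c.2

/-- `ξ₀ = 1 + (1 - q - N (1 - ηⁿ)^{λ₀}) / (3^{n+2} K₀)`. -/
def xi0 (n : ℕ) (K₀ N lam q η : ℝ) : ℝ :=
  1 + (1 - q - N * (1 - η ^ n) ^ lam) / (3 ^ (n + 2) * K₀)

/-- `ξ₁ = (l - 1) / (l + 1)`. -/
def xi1 (l : ℝ) : ℝ := (l - 1) / (l + 1)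

end WeightedCovering

end

/-! The height is chosen so that weighted cylinders have the size of unweighted ones: with `c` the
volume of the unit ball, Hölder's inequality and the `A_{1+1/n}` condition give `c ρ^(n+2) ≤ ω(C) ≤
K₀ c ρ^(n+2)` (`le_weight_mul_height`, `weight_mul_height_le`). Moreover `h_ρ/ρ` is a power of the
mass of `ω⁻ⁿ` on the ball, so it grows with the ball (`slope_mono`). These two facts yield doubling
of `ω` (`weight_ball_le`) and a Vitali covering by cylinders with constant `(1+2τ)^(n+2) K₀`, for
any `τ > 1` (`exists_disjoint_cyl`).

Points of `Γ` missed by the shrunken cylinders form a null set: small cylinders around them have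
density below `q`, which contradicts a Vitali covering inside an open set that barely exceeds the
missed set (`wMeasure_diff_setTilde`).

For `ξ₀`, suppose `Γ` has density at most `q` in the large cylinder. By continuity each admissible
cylinder sits in one of density exactly `q` (`exists_cyl_density_eq`). Such a cylinder has the
fraction `1 - q` outside `Γ`, and shrinking it loses at most the fraction `N(1-ηⁿ)^λ`, because thin
annuli have power-small weight (`weight_ball_diff_le`). Summing over a disjoint Vitali subfamily
bounds the part of the shrunken union outside `Γ` from below, and `τ → 1` turns `1+2τ` into 3.
Without a containing cylinder, one takes a huge one in which `Γ` has small density.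

For `ξ₁`, Fubini reduces the claim to intervals on a line (`volume_iUnion_shift_le`), handled on
each connected component of the forward union. -/

noncomputable section

namespace WeightedCovering

variable {n : ℕ} {ω : EuclideanSpace ℝ (Fin n) → ℝ} {K₀ : ℝ}

/-! ### Muckenhoupt weights: heights, cylinder size, doubling -/

/-- The measure `ω dx` on `ℝⁿ`. -/
def weight (ω : EuclideanSpace ℝ (Fin n) → ℝ) : Measure (EuclideanSpace ℝ (Fin n)) :=
  volume.withDensity fun x => ENNReal.ofReal (ω x)

/-- The dual measure `ω⁻ⁿ dx` on `ℝⁿ`. -/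
def dualWeight (ω : EuclideanSpace ℝ (Fin n) → ℝ) : Measure (EuclideanSpace ℝ (Fin n)) :=
  volume.withDensity fun x => ENNReal.ofReal (ω x ^ n)⁻¹

/-- The volume of the unit ball of `ℝⁿ`. -/
def unitBallVolume (n : ℕ) : ℝ := volume.real (Metric.ball (0 : EuclideanSpace ℝ (Fin n)) 1)

lemma unitBallVolume_pos : 0 < unitBallVolume n :=
  ENNReal.toReal_pos (Metric.measure_ball_pos _ _ one_pos).ne' measure_ball_lt_top.ne

lemma volume_real_ball (x : EuclideanSpace ℝ (Fin n)) {ρ : ℝ} (hρ : 0 < ρ) :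
    volume.real (Metric.ball x ρ) = unitBallVolume n * ρ ^ n := by
  rw [measureReal_def, Measure.addHaar_ball_of_pos _ _ hρ, ENNReal.toReal_mul,
    ENNReal.toReal_ofReal (by positivity), finrank_euclideanSpace_fin, mul_comm]
  rfl

lemma aemeasurable_weight (hω : IsAp (1 + 1 / (n : ℝ)) ω) : AEMeasurable ω volume :=
  hω.locallyIntegrable.aestronglyMeasurable.aemeasurable

lemma weight_ball_lt_top (hω : IsAp (1 + 1 / (n : ℝ)) ω) (x : EuclideanSpace ℝ (Fin n)) (ρ : ℝ) :
    weight ω (Metric.ball x ρ) < ∞ := by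
  rw [weight, withDensity_apply _ measurableSet_ball]
  have h := (hω.locallyIntegrable.integrableOn_isCompact (isCompact_closedBall x ρ)).mono_set
    Metric.ball_subset_closedBall
  exact h.lintegral_lt_top

lemma weight_ball_ne_zero (hω : IsAp (1 + 1 / (n : ℝ)) ω) (x : EuclideanSpace ℝ (Fin n)) {ρ : ℝ}
    (hρ : 0 < ρ) : weight ω (Metric.ball x ρ) ≠ 0 := by
  rw [weight, withDensity_apply _ measurableSet_ball]
  intro h
  rw [lintegral_eq_zero_iff' (aemeasurable_weight hω).restrict.ennreal_ofReal] at h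
  have h' : ∀ᵐ y ∂(volume.restrict (Metric.ball x ρ)), False := by
    filter_upwards [h, ae_restrict_of_ae hω.ae_pos] with y hy hy'
    simp at hy
    linarith
  rw [Filter.eventually_false_iff_eq_bot, ae_eq_bot, Measure.restrict_eq_zero] at h'
  exact (Metric.measure_ball_pos volume x hρ).ne' h'

lemma dualWeight_ball (hn : 1 ≤ n) (hω : IsAp (1 + 1 / (n : ℝ)) ω) (x : EuclideanSpace ℝ (Fin n))
    (ρ : ℝ) :
    dualWeight ω (Metric.ball x ρ) =
      ∫⁻ y in Metric.ball x ρ, ENNReal.ofReal (ω y) ^ (-(1 / ((1 + 1 / (n : ℝ)) - 1))) := by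
  rw [dualWeight, withDensity_apply _ measurableSet_ball]
  refine lintegral_congr_ae ?_
  filter_upwards [ae_restrict_of_ae hω.ae_pos] with y hy
  have : -(1 / ((1 + 1 / (n : ℝ)) - 1)) = -(n : ℝ) := by
    have : (n : ℝ) ≠ 0 := by positivity
    field_simp
    ring
  rw [this, ENNReal.ofReal_rpow_of_pos hy, Real.rpow_neg hy.le, Real.rpow_natCast]

lemma le_apConst (hn : 1 ≤ n) (hω : IsAp (1 + 1 / (n : ℝ)) ω) (x : EuclideanSpace ℝ (Fin n)) {ρ : ℝ}
    (hρ : 0 < ρ) :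
    weight ω (Metric.ball x ρ) / volume (Metric.ball x ρ) *
      (dualWeight ω (Metric.ball x ρ) / volume (Metric.ball x ρ)) ^ (1 / (n : ℝ)) ≤
    apConst (1 + 1 / (n : ℝ)) ω := by
  rw [dualWeight_ball hn hω, weight, withDensity_apply _ measurableSet_ball, apConst]
  refine le_trans (le_of_eq ?_) (le_iSup₂_of_le x ρ (le_iSup_of_le hρ le_rfl))
  congr 2
  ring

/-- The other factor in the `A_p` product is positive because `ω > 0` a.e., so an infinite dual mass
would make the `A_p` constant infinite. -/
lemma dualWeight_ball_lt_top (hn : 1 ≤ n) (hω : IsAp (1 + 1 / (n : ℝ)) ω)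
    (x : EuclideanSpace ℝ (Fin n)) (ρ : ℝ) : dualWeight ω (Metric.ball x ρ) < ∞ := by
  rcases le_or_gt ρ 0 with hρ | hρ
  · simp [Metric.ball_eq_empty.2 hρ]
  have h := (le_apConst hn hω x hρ).trans_lt hω.apConst_lt_top
  by_contra! h'
  rw [top_le_iff.1 h', ENNReal.top_div_of_ne_top measure_ball_lt_top.ne,
    ENNReal.top_rpow_of_pos (by positivity), ENNReal.mul_top] at h
  · exact lt_irrefl _ h
  · exact (ENNReal.div_pos (weight_ball_ne_zero hω x hρ) measure_ball_lt_top.ne).ne'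

/-- Hölder's inequality for `1 = ω ^ (n/(n+1)) * (ω⁻ⁿ) ^ (1/(n+1))`. -/
lemma volume_ball_le (hω : IsAp (1 + 1 / (n : ℝ)) ω)
    (x : EuclideanSpace ℝ (Fin n)) (ρ : ℝ) :
    volume (Metric.ball x ρ) ≤ weight ω (Metric.ball x ρ) ^ ((n : ℝ) / (n + 1)) *
      dualWeight ω (Metric.ball x ρ) ^ (1 / ((n : ℝ) + 1)) := by
  have hm := (aemeasurable_weight hω).restrict (s := Metric.ball x ρ)
  have h := ENNReal.lintegral_mul_norm_pow_le (μ := volume.restrict (Metric.ball x ρ))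
    hm.ennreal_ofReal (hm.pow_const n).inv.ennreal_ofReal
    (p := (n : ℝ) / (n + 1)) (q := 1 / ((n : ℝ) + 1)) (by positivity) (by positivity)
    (by field_simp)
  rw [weight, withDensity_apply _ measurableSet_ball, dualWeight,
    withDensity_apply _ measurableSet_ball]
  refine le_trans (le_of_eq ?_) h
  rw [← setLIntegral_one]
  refine lintegral_congr_ae ?_
  filter_upwards [ae_restrict_of_ae hω.ae_pos] with y hy
  simp only [Pi.inv_apply]
  rw [ENNReal.ofReal_rpow_of_pos hy, ENNReal.ofReal_rpow_of_pos (by positivity),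
    ← ENNReal.ofReal_mul (by positivity), ← Real.rpow_natCast, ← Real.rpow_neg hy.le,
    ← Real.rpow_mul hy.le, ← Real.rpow_add hy,
    show (n : ℝ) / (n + 1) + -n * (1 / (n + 1)) = 0 by ring]
  simp

/-- The ratio `height ω ρ x / ρ`. -/
def slope (ω : EuclideanSpace ℝ (Fin n) → ℝ) (ρ : ℝ) (x : EuclideanSpace ℝ (Fin n)) : ℝ :=
  ((dualWeight ω).real (Metric.ball x ρ) / unitBallVolume n) ^ (1 / (n : ℝ))

lemma slope_nonneg (ρ : ℝ) (x : EuclideanSpace ℝ (Fin n)) : 0 ≤ slope ω ρ x :=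
  Real.rpow_nonneg (div_nonneg measureReal_nonneg unitBallVolume_pos.le) _

lemma slope_mono (hn : 1 ≤ n) (hω : IsAp (1 + 1 / (n : ℝ)) ω) {x x' : EuclideanSpace ℝ (Fin n)}
    {ρ ρ' : ℝ} (h : dist x' x + ρ' ≤ ρ) : slope ω ρ' x' ≤ slope ω ρ x := by
  have := (unitBallVolume_pos (n := n)).le
  refine Real.rpow_le_rpow (div_nonneg measureReal_nonneg this) ?_ (by positivity)
  refine div_le_div_of_nonneg_right ?_ this
  refine measureReal_mono (Metric.ball_subset_ball' (by linarith)) ?_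
  exact (dualWeight_ball_lt_top hn hω x ρ).ne

lemma rpow_ball_factor (hn : 1 ≤ n) (a : ℝ) (ha : 0 ≤ a) {ρ : ℝ} (hρ : 0 < ρ) :
    (a / (unitBallVolume n * ρ ^ n)) ^ (1 / (n : ℝ)) =
      (a / unitBallVolume n) ^ (1 / (n : ℝ)) / ρ := by
  rw [← div_div, Real.div_rpow (div_nonneg ha unitBallVolume_pos.le) (by positivity), one_div,
    Real.pow_rpow_inv_natCast hρ.le (by omega)]

lemma height_eq (hn : 1 ≤ n) (hω : IsAp (1 + 1 / (n : ℝ)) ω) (x : EuclideanSpace ℝ (Fin n)) {ρ : ℝ}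
    (hρ : 0 < ρ) : height ω ρ x = ρ * slope ω ρ x := by
  have : (⨍ z in Metric.ball x ρ, (ω z ^ n)⁻¹) =
      (dualWeight ω).real (Metric.ball x ρ) / (unitBallVolume n * ρ ^ n) := by
    rw [setAverage_eq, volume_real_ball x hρ, smul_eq_mul, inv_mul_eq_div]
    congr 1
    rw [measureReal_def, dualWeight, withDensity_apply _ measurableSet_ball,
      integral_eq_lintegral_of_nonneg_ae]
    · exact Filter.Eventually.of_forall fun z => inv_nonneg.2 (pow_nonneg (hω.nonneg z) n)
    · exact ((aemeasurable_weight hω).restrict.pow_const n).inv.aestronglyMeasurable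
  rw [height, this, rpow_ball_factor hn _ measureReal_nonneg hρ, slope]
  field_simp

/-- The `A_p` product on the ball, cleared of its volume denominators. With the Hölder bound
`le_weight_mul_height` it pins the cylinder's measure to `ρ^(n+2)` up to the factor `K₀`. -/
lemma weight_mul_height_le (hn : 1 ≤ n) (hK₀ : 1 ≤ K₀) (hω : IsAp (1 + 1 / (n : ℝ)) ω)
    (hK : apConst (1 + 1 / (n : ℝ)) ω ≤ ENNReal.ofReal K₀) (x : EuclideanSpace ℝ (Fin n)) {ρ : ℝ}
    (hρ : 0 < ρ) :
    (weight ω).real (Metric.ball x ρ) * height ω ρ x ≤ K₀ * (unitBallVolume n * ρ ^ (n + 2)) := by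
  have h := ENNReal.toReal_mono ENNReal.ofReal_ne_top ((le_apConst hn hω x hρ).trans hK)
  have hc := unitBallVolume_pos (n := n)
  rw [ENNReal.toReal_ofReal (by linarith), ENNReal.toReal_mul, ← ENNReal.toReal_rpow,
    ENNReal.toReal_div, ENNReal.toReal_div, ← measureReal_def, ← measureReal_def,
    ← measureReal_def, volume_real_ball x hρ, rpow_ball_factor hn _ measureReal_nonneg hρ,
    ← slope, div_mul_div_comm, div_le_iff₀ (by positivity)] at h
  rw [height_eq hn hω x hρ]
  calc _ = (weight ω).real (Metric.ball x ρ) * slope ω ρ x * ρ := by ring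
    _ ≤ K₀ * (unitBallVolume n * ρ ^ n * ρ) * ρ := by gcongr
    _ = _ := by ring

lemma le_weight_mul_height (hn : 1 ≤ n) (hω : IsAp (1 + 1 / (n : ℝ)) ω)
    (x : EuclideanSpace ℝ (Fin n)) {ρ : ℝ} (hρ : 0 < ρ) :
    unitBallVolume n * ρ ^ (n + 2) ≤ (weight ω).real (Metric.ball x ρ) * height ω ρ x := by
  have hc := unitBallVolume_pos (n := n)
  have hn0 : (n : ℝ) ≠ 0 := by positivity
  have h := ENNReal.toReal_mono (ENNReal.mul_ne_top
    (ENNReal.rpow_ne_top_of_nonneg (by positivity) (weight_ball_lt_top hω x ρ).ne)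
    (ENNReal.rpow_ne_top_of_nonneg (by positivity) (dualWeight_ball_lt_top hn hω x ρ).ne))
    (volume_ball_le hω x ρ)
  rw [ENNReal.toReal_mul, ← ENNReal.toReal_rpow, ← ENNReal.toReal_rpow, ← measureReal_def,
    ← measureReal_def, ← measureReal_def, volume_real_ball x hρ] at h
  set m := (weight ω).real (Metric.ball x ρ)
  set S := (dualWeight ω).real (Metric.ball x ρ) with hS
  have hm : 0 ≤ m := measureReal_nonneg
  have hS0 : 0 ≤ S := measureReal_nonneg
  -- The power `(n+1)/n` turns the Hölder exponents `n/(n+1)` and `1/(n+1)` into `1` and `1/n`, the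
  -- exponents in the height.
  have h2 := Real.rpow_le_rpow (by positivity) h (z := ((n : ℝ) + 1) / n) (by positivity)
  rw [Real.mul_rpow (by positivity) (by positivity),
    Real.mul_rpow (by positivity) (by positivity), ← Real.rpow_mul hm, ← Real.rpow_mul hS0] at h2
  have e1 : (n : ℝ) / (n + 1) * ((n + 1) / n) = 1 := by field_simp
  have e2 : 1 / ((n : ℝ) + 1) * ((n + 1) / n) = 1 / n := by field_simp
  have e3 : ((n : ℝ) + 1) / n = 1 + 1 / n := by field_simp
  have e4 : (ρ ^ n) ^ (((n : ℝ) + 1) / n) = ρ ^ (n + 1) := by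
    rw [← Real.rpow_natCast, ← Real.rpow_mul hρ.le, ← Real.rpow_natCast]
    congr 1
    push_cast
    field_simp
  rw [e1, e2, e4, e3, Real.rpow_add hc, Real.rpow_one, Real.rpow_one] at h2
  rw [height_eq hn hω x hρ, slope, ← hS, Real.div_rpow hS0 hc.le]
  have hc' : 0 < unitBallVolume n ^ (1 / (n : ℝ)) := by positivity
  rw [← mul_div_assoc, ← mul_div_assoc, le_div_iff₀ hc']
  calc _ = unitBallVolume n * unitBallVolume n ^ (1 / (n : ℝ)) * ρ ^ (n + 1) * ρ := by ring
    _ ≤ m * S ^ (1 / (n : ℝ)) * ρ := by gcongr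
    _ = _ := by ring

lemma height_pos (hn : 1 ≤ n) (hω : IsAp (1 + 1 / (n : ℝ)) ω)
    (x : EuclideanSpace ℝ (Fin n)) {ρ : ℝ} (hρ : 0 < ρ) : 0 < height ω ρ x := by
  have h := le_weight_mul_height hn hω x hρ
  have hc := unitBallVolume_pos (n := n)
  have : 0 < unitBallVolume n * ρ ^ (n + 2) := by positivity
  exact pos_of_mul_pos_right (this.trans_le h) measureReal_nonneg

/-- Monotonicity of `height / ρ` in cross-multiplied form: passing to a larger ball, heights grow at
least linearly in the radius. -/
lemma mul_height_le (hn : 1 ≤ n) (hω : IsAp (1 + 1 / (n : ℝ)) ω) {x x' : EuclideanSpace ℝ (Fin n)}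
    {ρ ρ' : ℝ} (hρ : 0 < ρ) (hρ' : 0 < ρ') (h : dist x' x + ρ' ≤ ρ) :
    ρ * height ω ρ' x' ≤ ρ' * height ω ρ x := by
  rw [height_eq hn hω x hρ, height_eq hn hω x' hρ']
  have := slope_mono hn hω h
  calc _ = ρ * ρ' * slope ω ρ' x' := by ring
    _ ≤ ρ * ρ' * slope ω ρ x := by gcongr
    _ = _ := by ring

lemma height_mono (hn : 1 ≤ n) (hω : IsAp (1 + 1 / (n : ℝ)) ω) {x x' : EuclideanSpace ℝ (Fin n)}
    {ρ ρ' : ℝ} (hρ' : 0 < ρ') (h : dist x' x + ρ' ≤ ρ) :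
    height ω ρ' x' ≤ height ω ρ x := by
  have hle : ρ' ≤ ρ := by linarith [dist_nonneg (x := x') (y := x)]
  have hρ : 0 < ρ := hρ'.trans_le hle
  rw [height_eq hn hω x hρ, height_eq hn hω x' hρ']
  exact mul_le_mul hle (slope_mono hn hω h) (slope_nonneg _ _) hρ.le

/-- Dividing the two-sided cylinder bounds gives the ratio `(ρ/ρ')^(n+2)`; the linear growth of
heights removes one power. -/
lemma weight_ball_le (hn : 1 ≤ n) (hK₀ : 1 ≤ K₀) (hω : IsAp (1 + 1 / (n : ℝ)) ω)
    (hK : apConst (1 + 1 / (n : ℝ)) ω ≤ ENNReal.ofReal K₀) {x x' : EuclideanSpace ℝ (Fin n)}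
    {ρ ρ' : ℝ} (hρ' : 0 < ρ') (h : dist x' x + ρ' ≤ ρ) :
    (weight ω).real (Metric.ball x ρ) ≤
      K₀ * (ρ / ρ') ^ (n + 1) * (weight ω).real (Metric.ball x' ρ') := by
  have hle : ρ' ≤ ρ := by linarith [dist_nonneg (x := x') (y := x)]
  have hρ : 0 < ρ := hρ'.trans_le hle
  have h1 := weight_mul_height_le hn hK₀ hω hK x hρ
  have h2 := le_weight_mul_height hn hω x' hρ'
  have h3 := mul_height_le hn hω hρ hρ' h
  have hh' := height_pos hn hω x' hρ'
  set W := (weight ω).real (Metric.ball x ρ)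
  set W' := (weight ω).real (Metric.ball x' ρ')
  have hW : 0 ≤ W := measureReal_nonneg
  refine le_of_mul_le_mul_right ?_ (mul_pos hρ hh')
  calc W * (ρ * height ω ρ' x') ≤ W * (ρ' * height ω ρ x) := by gcongr
    _ = ρ' * (W * height ω ρ x) := by ring
    _ ≤ ρ' * (K₀ * (unitBallVolume n * ρ ^ (n + 2))) := by gcongr
    _ = K₀ * (ρ / ρ') ^ (n + 1) * ρ * (unitBallVolume n * ρ' ^ (n + 2)) := by
        rw [div_pow]
        field_simp
        ring
    _ ≤ K₀ * (ρ / ρ') ^ (n + 1) * ρ * (W' * height ω ρ' x') := by gcongr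
    _ = _ := by ring

/-! ### The weighted space-time measure -/

lemma wMeasure_eq_prod (hω : IsAp (1 + 1 / (n : ℝ)) ω) :
    wMeasure ω = (weight ω).prod volume := by
  rw [weight, prod_withDensity_left₀ (aemeasurable_weight hω).ennreal_ofReal]
  rfl

lemma wMeasure_absolutelyContinuous : wMeasure ω ≪ volume :=
  withDensity_absolutelyContinuous _ _

instance : SFinite (weight ω) := by unfold weight; infer_instance

lemma wMeasure_ball_prod_Ioo (hω : IsAp (1 + 1 / (n : ℝ)) ω) (x : EuclideanSpace ℝ (Fin n))
    (ρ a b : ℝ) :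
    wMeasure ω (Metric.ball x ρ ×ˢ Ioo a b) =
      weight ω (Metric.ball x ρ) * ENNReal.ofReal (b - a) := by
  rw [wMeasure_eq_prod hω, Measure.prod_prod, Real.volume_Ioo]

lemma wMeasure_cyl (hω : IsAp (1 + 1 / (n : ℝ)) ω) (ρ : ℝ)
    (X : EuclideanSpace ℝ (Fin n) × ℝ) :
    wMeasure ω (cyl ω ρ X) =
      ENNReal.ofReal ((weight ω).real (Metric.ball X.1 ρ) * height ω ρ X.1) := by
  rw [cyl, wMeasure_ball_prod_Ioo hω, sub_sub_cancel, ENNReal.ofReal_mul measureReal_nonneg,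
    ofReal_measureReal (weight_ball_lt_top hω _ _).ne]

lemma wMeasure_cyl_lt_top (hω : IsAp (1 + 1 / (n : ℝ)) ω) (ρ : ℝ)
    (X : EuclideanSpace ℝ (Fin n) × ℝ) : wMeasure ω (cyl ω ρ X) < ∞ := by
  rw [cyl, wMeasure_ball_prod_Ioo hω]
  exact ENNReal.mul_lt_top (weight_ball_lt_top hω _ _) ENNReal.ofReal_lt_top

lemma isOpen_cyl (ρ : ℝ) (X : EuclideanSpace ℝ (Fin n) × ℝ) : IsOpen (cyl ω ρ X) :=
  Metric.isOpen_ball.prod isOpen_Ioo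

lemma isOpen_cylTilde (η ρ : ℝ) (X : EuclideanSpace ℝ (Fin n) × ℝ) :
    IsOpen (cylTilde ω η ρ X) :=
  Metric.isOpen_ball.prod isOpen_Ioo

lemma isOpen_cylHat (η l ρ : ℝ) (X : EuclideanSpace ℝ (Fin n) × ℝ) :
    IsOpen (cylHat ω η l ρ X) :=
  Metric.isOpen_ball.prod isOpen_Ioo

lemma isOpen_setTilde (U Γ : Set (EuclideanSpace ℝ (Fin n) × ℝ)) (q η : ℝ) :
    IsOpen (setTilde ω U Γ q η) :=
  isOpen_biUnion fun _ _ => isOpen_cylTilde _ _ _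

lemma isOpen_setHat (U Γ : Set (EuclideanSpace ℝ (Fin n) × ℝ)) (q η l : ℝ) :
    IsOpen (setHat ω U Γ q η l) :=
  isOpen_biUnion fun _ _ => isOpen_cylHat _ _ _ _

lemma isLocallyFiniteMeasure_wMeasure (hω : IsAp (1 + 1 / (n : ℝ)) ω) :
    IsLocallyFiniteMeasure (wMeasure ω) := by
  refine ⟨fun X => ⟨Metric.ball X.1 1 ×ˢ Ioo (X.2 - 1) (X.2 + 1), ?_, ?_⟩⟩
  · exact (Metric.isOpen_ball.prod isOpen_Ioo).mem_nhds
      ⟨Metric.mem_ball_self one_pos, by simp, by simp⟩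
  · rw [wMeasure_ball_prod_Ioo hω]
    exact ENNReal.mul_lt_top (weight_ball_lt_top hω _ _) ENNReal.ofReal_lt_top

/-! ### Power decay of the weight of thin annuli -/

/-- Move `z` radially inward by `2e`. The point stays at least `e` from the bounding spheres of the
inner annulus; `4e ≤ ρ` ensures that the move does not pass the centre. -/
lemma exists_ball_inside {x z : EuclideanSpace ℝ (Fin n)} {ρ e : ℝ} (he : 0 < e) (heρ : 4 * e ≤ ρ)
    (hz : z ∈ Metric.ball x ρ \ Metric.ball x (ρ - e)) :
    ∃ z', dist z z' = 2 * e ∧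
      Metric.ball z' e ⊆ Metric.ball x (ρ - e) \ Metric.ball x (ρ - 4 * e) := by
  obtain ⟨hz1, hz2⟩ := hz
  rw [Metric.mem_ball] at hz1
  rw [Metric.mem_ball, not_lt] at hz2
  have hd : 0 < ‖z - x‖ := by rw [← dist_eq_norm]; linarith
  rw [dist_eq_norm] at hz1 hz2
  refine ⟨z - (2 * e / ‖z - x‖) • (z - x), ?_, ?_⟩
  · rw [dist_eq_norm, sub_sub_cancel, norm_smul, Real.norm_of_nonneg (by positivity)]
    field_simp
  · have hx : dist (z - (2 * e / ‖z - x‖) • (z - x)) x = ‖z - x‖ - 2 * e := by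
      have h1 : z - (2 * e / ‖z - x‖) • (z - x) - x = (1 - 2 * e / ‖z - x‖) • (z - x) := by
        rw [sub_smul, one_smul]; abel
      rw [dist_eq_norm, h1, norm_smul, Real.norm_of_nonneg, sub_mul, one_mul,
        div_mul_cancel₀ _ hd.ne']
      rw [sub_nonneg, div_le_one hd]
      linarith
    intro w hw
    rw [Metric.mem_ball] at hw
    have h2 := dist_triangle w (z - (2 * e / ‖z - x‖) • (z - x)) x
    have h3 := dist_triangle_left (z - (2 * e / ‖z - x‖) • (z - x)) x w
    rw [hx] at h2 h3
    refine ⟨?_, ?_⟩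
    · rw [Metric.mem_ball]; linarith
    · rw [Metric.mem_ball, not_lt]; linarith

/-- By doubling, a thin outer annulus carries at most a fixed multiple of the weight of the
neighbouring inner annulus. -/
lemma weight_annulus_le (hn : 1 ≤ n) (hK₀ : 1 ≤ K₀) (hω : IsAp (1 + 1 / (n : ℝ)) ω)
    (hK : apConst (1 + 1 / (n : ℝ)) ω ≤ ENNReal.ofReal K₀) (x : EuclideanSpace ℝ (Fin n))
    {ρ e : ℝ} (he : 0 < e) (heρ : 4 * e ≤ ρ) :
    weight ω (Metric.ball x ρ \ Metric.ball x (ρ - e)) ≤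
      ENNReal.ofReal (K₀ * 18 ^ (n + 1)) *
        weight ω (Metric.ball x (ρ - e) \ Metric.ball x (ρ - 4 * e)) := by
  set A := Metric.ball x ρ \ Metric.ball x (ρ - e) with hA
  -- Radius `3e` makes the ball around `z` contain the inner ball of radius `e` whose centre is `2e`
  -- away, so the inner balls inherit disjointness.
  obtain ⟨u, huA, hdisj, hcov⟩ := Vitali.exists_disjoint_subfamily_covering_enlargement_closedBall
    A id (fun _ => 3 * e) (3 * e) (fun _ _ => le_rfl) 5 (by norm_num)
  have hcount : u.Countable := hdisj.countable_of_nonempty_interior fun z _ => by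
    refine ⟨z, interior_mono Metric.ball_subset_closedBall ?_⟩
    rw [Metric.isOpen_ball.interior_eq]
    exact Metric.mem_ball_self (by linarith)
  choose! c hc1 hc2 using fun z (hz : z ∈ A) => exists_ball_inside he heρ hz
  have hdisj' : u.PairwiseDisjoint fun z => Metric.ball (c z) e := by
    refine hdisj.mono_on fun z hz => ?_
    refine (Metric.ball_subset_ball' ?_).trans Metric.ball_subset_closedBall
    have := hc1 z (huA hz)
    rw [dist_comm] at this
    simp only [id, this]
    linarith
  have hball : ∀ z ∈ u, weight ω (Metric.closedBall z (5 * (3 * e))) ≤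
      ENNReal.ofReal (K₀ * 18 ^ (n + 1)) * weight ω (Metric.ball (c z) e) := by
    intro z hz
    -- The enlarged ball of radius `15e`, seen from a centre `2e` away, needs radius at least `17e`;
    -- `18e` suffices and fixes the constant.
    have h := weight_ball_le hn hK₀ hω hK (x := c z) (x' := c z) (ρ := 18 * e) he
      (by rw [dist_self]; linarith)
    rw [mul_div_assoc, div_self he.ne', mul_one] at h
    calc _ ≤ weight ω (Metric.ball (c z) (18 * e)) := by
          refine measure_mono (Metric.closedBall_subset_ball' ?_)
          rw [hc1 z (huA hz)]
          linarith
      _ ≤ _ := by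
          rw [← ofReal_measureReal (weight_ball_lt_top hω (c z) (18 * e)).ne,
            ← ofReal_measureReal (weight_ball_lt_top hω (c z) e).ne,
            ← ENNReal.ofReal_mul (by positivity)]
          exact ENNReal.ofReal_le_ofReal h
  calc weight ω A ≤ weight ω (⋃ z ∈ u, Metric.closedBall z (5 * (3 * e))) := by
        refine measure_mono fun z hz => ?_
        obtain ⟨b, hb, hzb⟩ := hcov z hz
        exact mem_biUnion hb (hzb (Metric.mem_closedBall_self (by linarith)))
    _ ≤ ∑' z : u, weight ω (Metric.closedBall (z : EuclideanSpace ℝ (Fin n)) (5 * (3 * e))) :=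
        measure_biUnion_le _ hcount _
    _ ≤ ∑' z : u, ENNReal.ofReal (K₀ * 18 ^ (n + 1)) * weight ω (Metric.ball (c z) e) :=
        ENNReal.tsum_le_tsum fun z => hball z z.2
    _ = ENNReal.ofReal (K₀ * 18 ^ (n + 1)) * weight ω (⋃ z ∈ u, Metric.ball (c z) e) := by
        rw [ENNReal.tsum_mul_left, measure_biUnion hcount hdisj' fun _ _ => measurableSet_ball]
    _ ≤ _ := by
        gcongr
        exact iUnion₂_subset fun z hz => hc2 z (huA hz)

/-- Decay factor of the weight of annuli when their width is divided by four. -/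
def decayFactor (n : ℕ) (K₀ : ℝ) : ℝ := K₀ * 18 ^ (n + 1) / (K₀ * 18 ^ (n + 1) + 1)

lemma decayFactor_pos (hK₀ : 1 ≤ K₀) : 0 < decayFactor n K₀ := by
  unfold decayFactor
  positivity

lemma decayFactor_lt_one (hK₀ : 1 ≤ K₀) : decayFactor n K₀ < 1 := by
  unfold decayFactor
  rw [div_lt_one (by positivity)]
  linarith

/-- Hole filling: if `m(A) ≤ C m(A')` for adjacent disjoint annuli, adding `C m(A)` to both sides
gives the factor `C/(C+1) < 1` against the union. -/
lemma weight_annulus_decay (hn : 1 ≤ n) (hK₀ : 1 ≤ K₀) (hω : IsAp (1 + 1 / (n : ℝ)) ω)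
    (hK : apConst (1 + 1 / (n : ℝ)) ω ≤ ENNReal.ofReal K₀) (x : EuclideanSpace ℝ (Fin n))
    {ρ e : ℝ} (he : 0 < e) (heρ : 4 * e ≤ ρ) :
    (weight ω).real (Metric.ball x ρ \ Metric.ball x (ρ - e)) ≤
      decayFactor n K₀ * (weight ω).real (Metric.ball x ρ \ Metric.ball x (ρ - 4 * e)) := by
  have hfin : ∀ s ⊆ Metric.ball x ρ, weight ω s ≠ ∞ := fun s hs =>
    ((measure_mono hs).trans_lt (weight_ball_lt_top hω x ρ)).ne
  have hb : Metric.ball x (ρ - e) ⊆ Metric.ball x ρ := Metric.ball_subset_ball (by linarith)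
  have hb' : Metric.ball x (ρ - 4 * e) ⊆ Metric.ball x (ρ - e) :=
    Metric.ball_subset_ball (by linarith)
  have h := ENNReal.toReal_mono (ENNReal.mul_ne_top ENNReal.ofReal_ne_top
    (hfin _ (sdiff_subset.trans hb))) (weight_annulus_le hn hK₀ hω hK x he heρ)
  rw [ENNReal.toReal_mul, ENNReal.toReal_ofReal (by positivity), ← measureReal_def,
    ← measureReal_def] at h
  have hunion : Metric.ball x ρ \ Metric.ball x (ρ - 4 * e) =
      (Metric.ball x ρ \ Metric.ball x (ρ - e)) ∪
        (Metric.ball x (ρ - e) \ Metric.ball x (ρ - 4 * e)) :=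
    (sdiff_union_sdiff_cancel hb hb').symm
  rw [hunion, measureReal_union (disjoint_sdiff_left.mono_right sdiff_subset)
    (measurableSet_ball.diff measurableSet_ball) (hfin _ sdiff_subset)
    (hfin _ (sdiff_subset.trans hb)), decayFactor, div_mul_eq_mul_div, le_div_iff₀ (by positivity)]
  linarith

/-- The exponent of the power decay of the weight of annuli. -/
def decayExponent (n : ℕ) (K₀ : ℝ) : ℝ := -Real.log (decayFactor n K₀) / Real.log 4

lemma decayExponent_pos (hK₀ : 1 ≤ K₀) : 0 < decayExponent n K₀ :=
  div_pos (neg_pos.2 (Real.log_neg (decayFactor_pos hK₀) (decayFactor_lt_one hK₀)))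
    (Real.log_pos (by norm_num))

lemma four_rpow_decayExponent (hK₀ : 1 ≤ K₀) :
    (1 / 4 : ℝ) ^ decayExponent n K₀ = decayFactor n K₀ := by
  have h4 : Real.log 4 ≠ 0 := (Real.log_pos (by norm_num)).ne'
  rw [Real.rpow_def_of_pos (by norm_num), one_div, Real.log_inv, decayExponent]
  rw [show -Real.log 4 * (-Real.log (decayFactor n K₀) / Real.log 4) =
    Real.log (decayFactor n K₀) by field_simp, Real.exp_log (decayFactor_pos hK₀)]

/-- Each quartering of the width costs `decayFactor`, which is `(1/4)` to the power `decayExponent`.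
The prefactor `decayFactor⁻¹` makes the bound trivial for relative widths between `1/4` and `1`,
where the induction starts. -/
lemma weight_annulus_power (hn : 1 ≤ n) (hK₀ : 1 ≤ K₀) (hω : IsAp (1 + 1 / (n : ℝ)) ω)
    (hK : apConst (1 + 1 / (n : ℝ)) ω ≤ ENNReal.ofReal K₀) (x : EuclideanSpace ℝ (Fin n))
    {ρ : ℝ} (hρ : 0 < ρ) (k : ℕ) :
    ∀ δ : ℝ, (1 / 4) ^ (k + 1) ≤ δ → δ ≤ (1 / 4) ^ k →
      (weight ω).real (Metric.ball x ρ \ Metric.ball x (ρ - δ * ρ)) ≤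
        (decayFactor n K₀)⁻¹ * δ ^ decayExponent n K₀ * (weight ω).real (Metric.ball x ρ) := by
  have hθ := decayFactor_pos (n := n) hK₀
  have hexp := decayExponent_pos (n := n) hK₀
  induction k with
  | zero =>
    intro δ h1 h2
    have h3 : decayFactor n K₀ ≤ δ ^ decayExponent n K₀ := by
      rw [← four_rpow_decayExponent hK₀]
      exact Real.rpow_le_rpow (by norm_num) (by linarith) hexp.le
    calc _ ≤ (weight ω).real (Metric.ball x ρ) :=
          measureReal_mono sdiff_subset (weight_ball_lt_top hω x ρ).ne
      _ ≤ _ := by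
          refine le_mul_of_one_le_left measureReal_nonneg ?_
          rwa [inv_mul_eq_div, one_le_div hθ]
  | succ k ih =>
    intro δ h1 h2
    have hδ : 0 < δ := lt_of_lt_of_le (by positivity) h1
    have h4 : (4 * δ) ^ decayExponent n K₀ * decayFactor n K₀ = δ ^ decayExponent n K₀ := by
      rw [← four_rpow_decayExponent hK₀, ← Real.mul_rpow (by positivity) (by norm_num)]
      congr 1
      ring
    have hk : (1 / 4 : ℝ) ^ k ≤ 1 := pow_le_one₀ (by norm_num) (by norm_num)
    have h4δ : 4 * δ ≤ 1 := by
      rw [pow_succ] at h2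
      linarith
    have hdec := weight_annulus_decay hn hK₀ hω hK x (ρ := ρ) (e := δ * ρ) (by positivity)
      (by nlinarith)
    have hih := ih (4 * δ) (by rw [pow_succ] at h1; linarith) (by rw [pow_succ] at h2; linarith)
    calc _ ≤ decayFactor n K₀ *
          (weight ω).real (Metric.ball x ρ \ Metric.ball x (ρ - 4 * (δ * ρ))) := hdec
      _ ≤ decayFactor n K₀ * ((decayFactor n K₀)⁻¹ * (4 * δ) ^ decayExponent n K₀ *
          (weight ω).real (Metric.ball x ρ)) := by
          rw [← mul_assoc 4]
          gcongr
      _ = _ := by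
          rw [← h4]
          ring

lemma weight_ball_diff_le (hn : 1 ≤ n) (hK₀ : 1 ≤ K₀) (hω : IsAp (1 + 1 / (n : ℝ)) ω)
    (hK : apConst (1 + 1 / (n : ℝ)) ω ≤ ENNReal.ofReal K₀) (x : EuclideanSpace ℝ (Fin n))
    {ρ η : ℝ} (hρ : 0 < ρ) (hη : η ∈ Ioo (0 : ℝ) 1) :
    (weight ω).real (Metric.ball x ρ \ Metric.ball x (η * ρ)) ≤
      (decayFactor n K₀)⁻¹ * (1 - η ^ n) ^ decayExponent n K₀ *
        (weight ω).real (Metric.ball x ρ) := by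
  have hδ : 0 < 1 - η := by linarith [hη.2]
  obtain ⟨k, hk1, hk2⟩ := exists_nat_pow_near_of_lt_one hδ (by linarith [hη.1])
    (show (0 : ℝ) < 1 / 4 by norm_num) (by norm_num)
  have h := weight_annulus_power hn hK₀ hω hK x hρ k (1 - η) hk1.le hk2
  rw [show ρ - (1 - η) * ρ = η * ρ by ring] at h
  have hθ := decayFactor_pos (n := n) hK₀
  have hηn : η ^ n ≤ η := pow_le_of_le_one hη.1.le hη.2.le (by omega)
  refine h.trans ?_
  gcongr
  exact (decayExponent_pos hK₀).le

/-! ### Forward shift in time: the factor `ξ₁` -/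

lemma volume_iUnion_shift_le_of_ordConnected {ι : Type*} (T : Set ι) (s h : ι → ℝ)
    (hh : ∀ i ∈ T, 0 < h i) {l : ℝ} (hl : 1 < l) {K : Set ℝ} (hK : K.OrdConnected)
    (hTK : ∀ i ∈ T, Ioo (s i + h i) (s i + l * h i) ⊆ K) :
    volume (⋃ i ∈ T, Ioo (s i - h i) (s i)) ≤ ENNReal.ofReal ((l + 1) / (l - 1)) * volume K := by
  have hl' : 0 < l - 1 := by linarith
  rcases T.eq_empty_or_nonempty with rfl | ⟨i₀, hi₀⟩
  · simp
  by_cases htop : volume K = ∞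
  · rw [htop, ENNReal.mul_top]
    · exact le_top
    · rw [Ne, ENNReal.ofReal_eq_zero, not_le]
      exact div_pos (by linarith) hl'
  have hlt : ∀ i ∈ T, s i + h i < s i + l * h i := fun i hi => by nlinarith [hh i hi]
  have hKne : K.Nonempty := (nonempty_Ioo.2 (hlt i₀ hi₀)).mono (hTK i₀ hi₀)
  set L := (volume K).toReal with hL
  have hLK : ENNReal.ofReal L = volume K := ENNReal.ofReal_toReal htop
  have hdiam : ∀ x ∈ K, ∀ y ∈ K, y - x ≤ L := by
    intro x hx y hy
    have := measure_mono (μ := volume) (hK.out hx hy)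
    rw [Real.volume_Icc, ← hLK] at this
    exact (ENNReal.ofReal_le_ofReal_iff ENNReal.toReal_nonneg).1 this
  obtain ⟨x₀, hx₀⟩ := hKne
  have hba : BddAbove K := ⟨x₀ + L, fun y hy => by linarith [hdiam x₀ hx₀ y hy]⟩
  have hbb : BddBelow K := ⟨x₀ - L, fun y hy => by linarith [hdiam y hy x₀ hx₀]⟩
  have hab : sSup K - sInf K ≤ L := by
    have : sSup K ≤ L + sInf K := csSup_le ⟨x₀, hx₀⟩ fun y hy => by
      have : y - L ≤ sInf K := le_csInf ⟨x₀, hx₀⟩ fun x hx => by linarith [hdiam x hx y hy]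
      linarith
    linarith
  -- The forward interval has length `(l-1)h ≤ L`, and the backward one starts `2h` before it. So
  -- the union reaches at most `2L/(l-1)` below `K`, for total length at most `L(l+1)/(l-1)`.
  have hsub : (⋃ i ∈ T, Ioo (s i - h i) (s i)) ⊆ Ioo (sInf K - 2 * L / (l - 1)) (sSup K) := by
    refine iUnion₂_subset fun i hi => Ioo_subset_Ioo ?_ ?_
    · have h1 : sInf K ≤ s i + h i := by
        rw [← csInf_Ioo (hlt i hi)]
        exact csInf_le_csInf hbb (nonempty_Ioo.2 (hlt i hi)) (hTK i hi)
      have h2 : (l - 1) * h i ≤ L := by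
        have := measure_mono (μ := volume) (hTK i hi)
        rw [Real.volume_Ioo, ← hLK, ENNReal.ofReal_le_ofReal_iff ENNReal.toReal_nonneg] at this
        linarith
      have h3 : 2 * h i ≤ 2 * L / (l - 1) := by
        rw [le_div_iff₀ hl']
        linarith
      linarith
    · have h1 : s i + l * h i ≤ sSup K := by
        rw [← csSup_Ioo (hlt i hi)]
        exact csSup_le_csSup hba (nonempty_Ioo.2 (hlt i hi)) (hTK i hi)
      nlinarith [hh i hi]
  calc _ ≤ ENNReal.ofReal (sSup K - (sInf K - 2 * L / (l - 1))) := by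
        rw [← Real.volume_Ioo]
        exact measure_mono hsub
    _ ≤ ENNReal.ofReal ((l + 1) / (l - 1) * L) := by
        refine ENNReal.ofReal_le_ofReal ?_
        have : (l + 1) / (l - 1) * L = L + 2 * L / (l - 1) := by
          field_simp
          ring
        linarith
    _ = _ := by rw [ENNReal.ofReal_mul (div_nonneg (by linarith) hl'.le), hLK]

/-- One-dimensional comparison of a union of intervals with the union of the intervals that
lie ahead of them. -/
lemma volume_iUnion_shift_le {ι : Type*} (T : Set ι) (s h : ι → ℝ)
    (hh : ∀ i ∈ T, 0 < h i) {l : ℝ} (hl : 1 < l) :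
    volume (⋃ i ∈ T, Ioo (s i - h i) (s i)) ≤ ENNReal.ofReal ((l + 1) / (l - 1)) *
      volume (⋃ i ∈ T, Ioo (s i + h i) (s i + l * h i)) := by
  set U := ⋃ i ∈ T, Ioo (s i + h i) (s i + l * h i) with hU
  have hUo : IsOpen U := isOpen_biUnion fun _ _ => isOpen_Ioo
  -- The components are disjoint and open, hence countably many, and each forward interval lies in
  -- one of them; the estimate is summed over components.
  set 𝒦 := connectedComponentIn U '' U with h𝒦
  have hdisj : 𝒦.PairwiseDisjoint id := by
    rintro _ ⟨x, hx, rfl⟩ _ ⟨y, hy, rfl⟩ hne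
    refine Set.disjoint_left.2 fun z hz1 hz2 => hne ?_
    exact (connectedComponentIn_eq hz1).trans (connectedComponentIn_eq hz2).symm
  have hopen : ∀ K ∈ 𝒦, IsOpen (id K) := by
    rintro _ ⟨x, hx, rfl⟩
    exact hUo.connectedComponentIn
  have hcount : 𝒦.Countable := hdisj.countable_of_isOpen hopen fun K hK => by
    obtain ⟨x, hx, rfl⟩ := hK
    exact ⟨x, mem_connectedComponentIn hx⟩
  have hcov : (⋃ i ∈ T, Ioo (s i - h i) (s i)) ⊆ ⋃ K ∈ 𝒦,
      ⋃ i ∈ {i ∈ T | Ioo (s i + h i) (s i + l * h i) ⊆ K}, Ioo (s i - h i) (s i) := by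
    refine iUnion₂_subset fun i hi t ht => ?_
    have hlt : s i + h i < s i + l * h i := by nlinarith [hh i hi]
    obtain ⟨x, hx⟩ := nonempty_Ioo.2 hlt
    have hiU : Ioo (s i + h i) (s i + l * h i) ⊆ U :=
      subset_biUnion_of_mem (u := fun i => Ioo (s i + h i) (s i + l * h i)) hi
    refine mem_biUnion (mem_image_of_mem _ (hiU hx)) (mem_biUnion ⟨hi, ?_⟩ ht)
    exact isPreconnected_Ioo.subset_connectedComponentIn hx hiU
  calc _ ≤ _ := measure_mono hcov
    _ ≤ ∑' K : 𝒦, volume (⋃ i ∈ {i ∈ T | Ioo (s i + h i) (s i + l * h i) ⊆ K},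
          Ioo (s i - h i) (s i)) := measure_biUnion_le _ hcount _
    _ ≤ ∑' K : 𝒦, ENNReal.ofReal ((l + 1) / (l - 1)) * volume (K : Set ℝ) := by
        refine ENNReal.tsum_le_tsum fun K => ?_
        refine volume_iUnion_shift_le_of_ordConnected _ s h (fun i hi => hh i hi.1) hl ?_
          fun i hi => hi.2
        obtain ⟨_, x, hx, rfl⟩ := K
        exact isPreconnected_connectedComponentIn.ordConnected
    _ = ENNReal.ofReal ((l + 1) / (l - 1)) * volume (⋃ K ∈ 𝒦, id K) := by
        rw [ENNReal.tsum_mul_left, measure_biUnion hcount hdisj fun K hK => (hopen K hK).measurableSet]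
        rfl
    _ ≤ _ := by
        gcongr
        refine iUnion₂_subset ?_
        rintro _ ⟨x, hx, rfl⟩
        exact connectedComponentIn_subset U x

lemma xi1_mul_setTilde_le (hn : 1 ≤ n) (hω : IsAp (1 + 1 / (n : ℝ)) ω)
    (U Γ : Set (EuclideanSpace ℝ (Fin n) × ℝ)) (q η : ℝ) {l : ℝ} (hl : 1 < l) :
    ENNReal.ofReal (xi1 l) * wMeasure ω (setTilde ω U Γ q η) ≤
      wMeasure ω (setHat ω U Γ q η l) := by
  have hslice : ∀ x, volume (Prod.mk x ⁻¹' setTilde ω U Γ q η) ≤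
      ENNReal.ofReal ((l + 1) / (l - 1)) * volume (Prod.mk x ⁻¹' setHat ω U Γ q η l) := by
    intro x
    have h := volume_iUnion_shift_le
      {c ∈ family ω U Γ q | x ∈ Metric.ball c.2.1 (η * c.1)}
      (fun c => c.2.2) (fun c => height ω c.1 c.2.1)
      (fun c hc => height_pos hn hω _ hc.1.1) hl
    convert h using 3
    · ext t
      simp only [setTilde, cylTilde, mem_preimage, mem_iUnion, mem_prod, mem_ofPred_eq, exists_prop,
        and_assoc]
    · ext t
      simp only [setHat, cylHat, mem_preimage, mem_iUnion, mem_prod, mem_ofPred_eq, exists_prop,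
        and_assoc]
  have hle : wMeasure ω (setTilde ω U Γ q η) ≤
      ENNReal.ofReal ((l + 1) / (l - 1)) * wMeasure ω (setHat ω U Γ q η l) := by
    rw [wMeasure_eq_prod hω, Measure.prod_apply (isOpen_setTilde _ _ _ _).measurableSet,
      Measure.prod_apply (isOpen_setHat _ _ _ _ _).measurableSet,
      ← lintegral_const_mul' _ _ ENNReal.ofReal_ne_top]
    exact lintegral_mono hslice
  calc _ ≤ ENNReal.ofReal (xi1 l) *
        (ENNReal.ofReal ((l + 1) / (l - 1)) * wMeasure ω (setHat ω U Γ q η l)) := by gcongr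
    _ = _ := by
        have h1 : 0 < l - 1 := by linarith
        have h2 : 0 < l + 1 := by linarith
        rw [← mul_assoc, ← ENNReal.ofReal_mul (by unfold xi1; positivity), xi1,
          div_mul_div_cancel₀ h2.ne', div_self h1.ne', ENNReal.ofReal_one, one_mul]

/-! ### Vitali covering by weighted cylinders -/

lemma wMeasure_cyl_le (hn : 1 ≤ n) (hK₀ : 1 ≤ K₀) (hω : IsAp (1 + 1 / (n : ℝ)) ω)
    (hK : apConst (1 + 1 / (n : ℝ)) ω ≤ ENNReal.ofReal K₀) {ρ : ℝ} (hρ : 0 < ρ)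
    (X : EuclideanSpace ℝ (Fin n) × ℝ) :
    wMeasure ω (cyl ω ρ X) ≤ ENNReal.ofReal (K₀ * (unitBallVolume n * ρ ^ (n + 2))) := by
  rw [wMeasure_cyl hω]
  exact ENNReal.ofReal_le_ofReal (weight_mul_height_le hn hK₀ hω hK _ hρ)

lemma le_wMeasure_cyl (hn : 1 ≤ n) (hω : IsAp (1 + 1 / (n : ℝ)) ω) {ρ : ℝ} (hρ : 0 < ρ)
    (X : EuclideanSpace ℝ (Fin n) × ℝ) :
    ENNReal.ofReal (unitBallVolume n * ρ ^ (n + 2)) ≤ wMeasure ω (cyl ω ρ X) := by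
  rw [wMeasure_cyl hω]
  exact ENNReal.ofReal_le_ofReal (le_weight_mul_height hn hω _ hρ)

lemma cyl_nonempty (hn : 1 ≤ n) (hω : IsAp (1 + 1 / (n : ℝ)) ω) {ρ : ℝ} (hρ : 0 < ρ)
    (X : EuclideanSpace ℝ (Fin n) × ℝ) : (cyl ω ρ X).Nonempty :=
  (Metric.nonempty_ball.2 hρ).prod (nonempty_Ioo.2 (by linarith [height_pos hn hω X.1 hρ]))

/-- A cylinder engulfs, after spatial dilation by `1 + 2τ`, every cylinder that meets it and has
at most `τ` times its radius. -/
lemma cyl_subset_dilation (hn : 1 ≤ n) (hω : IsAp (1 + 1 / (n : ℝ)) ω) {τ : ℝ} (hτ : 1 < τ)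
    {ρ ρ' : ℝ} (hρ : 0 < ρ) (hρ' : 0 < ρ') (hle : ρ' ≤ τ * ρ)
    {X X' : EuclideanSpace ℝ (Fin n) × ℝ} (hne : (cyl ω ρ' X' ∩ cyl ω ρ X).Nonempty) :
    cyl ω ρ' X' ⊆ cyl ω ((1 + 2 * τ) * ρ)
      (X.1, X.2 + τ / (1 + 2 * τ) * height ω ((1 + 2 * τ) * ρ) X.1) := by
  obtain ⟨Y, ⟨hY1', hY2'⟩, hY1, hY2⟩ := hne
  rw [Metric.mem_ball] at hY1 hY1'
  have hM : 0 < 1 + 2 * τ := by linarith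
  have hdist : dist X'.1 X.1 < ρ' + ρ := by
    have := dist_triangle_left X'.1 X.1 Y.1
    linarith
  have hincl : dist X'.1 X.1 + ρ' ≤ (1 + 2 * τ) * ρ := by linarith
  have hh' := mul_height_le hn hω (by positivity) hρ' hincl
  have hh := mul_height_le hn hω (x := X.1) (x' := X.1) (ρ := (1 + 2 * τ) * ρ) (by positivity) hρ
    (by rw [dist_self]; nlinarith)
  have hH := height_pos hn hω X.1 (ρ := (1 + 2 * τ) * ρ) (by positivity)
  set H := height ω ((1 + 2 * τ) * ρ) X.1
  -- Time bookkeeping: `h' ≤ τH/(1+2τ)` and `h ≤ H/(1+2τ)`. Raising the top by `τH/(1+2τ)` leaves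
  -- room for `h'` above `X`, and the remaining `(1+τ)H/(1+2τ)` holds `h + h'` below.
  have h1 : (1 + 2 * τ) * height ω ρ' X'.1 ≤ τ * H := by
    refine le_of_mul_le_mul_right ?_ hρ
    calc _ = (1 + 2 * τ) * ρ * height ω ρ' X'.1 := by ring
      _ ≤ ρ' * H := hh'
      _ ≤ τ * ρ * H := by gcongr
      _ = _ := by ring
  have h2 : (1 + 2 * τ) * height ω ρ X.1 ≤ H := by
    refine le_of_mul_le_mul_right ?_ hρ
    linarith
  have h1' : height ω ρ' X'.1 ≤ τ / (1 + 2 * τ) * H := by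
    rw [div_mul_eq_mul_div, le_div_iff₀ hM]
    linarith
  have h2' : height ω ρ X.1 ≤ H - 2 * (τ / (1 + 2 * τ) * H) := by
    refine le_of_mul_le_mul_left ?_ hM
    refine h2.trans (le_of_eq ?_)
    field_simp
    ring
  refine prod_mono (Metric.ball_subset_ball' (by linarith)) (Ioo_subset_Ioo ?_ ?_)
  · have := hY2.1
    have := hY2'.2
    simp only
    linarith
  · have := hY2.2
    have := hY2'.1
    simp only
    linarith

/-- Vitali covering lemma for weighted cylinders. -/
lemma exists_disjoint_cyl (hn : 1 ≤ n) (hK₀ : 1 ≤ K₀) (hω : IsAp (1 + 1 / (n : ℝ)) ω)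
    (hK : apConst (1 + 1 / (n : ℝ)) ω ≤ ENNReal.ofReal K₀)
    (T : Set (ℝ × (EuclideanSpace ℝ (Fin n) × ℝ))) (hpos : ∀ c ∈ T, 0 < c.1) (R : ℝ)
    (hR : ∀ c ∈ T, c.1 ≤ R) {τ : ℝ} (hτ : 1 < τ) :
    ∃ u ⊆ T, u.Countable ∧ u.PairwiseDisjoint (fun c => cyl ω c.1 c.2) ∧
      wMeasure ω (⋃ c ∈ T, cyl ω c.1 c.2) ≤
        ENNReal.ofReal ((1 + 2 * τ) ^ (n + 2) * K₀) * ∑' c : u, wMeasure ω (cyl ω c.1.1 c.1.2) := by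
  have hne : ∀ c ∈ T, (cyl ω c.1 c.2).Nonempty := fun c hc => cyl_nonempty hn hω (hpos c hc) c.2
  obtain ⟨u, huT, hdisj, hcov⟩ := Vitali.exists_disjoint_subfamily_covering_enlargement
    (fun c : ℝ × (EuclideanSpace ℝ (Fin n) × ℝ) => cyl ω c.1 c.2) T (fun c => c.1) τ hτ
    (fun c hc => (hpos c hc).le) R hR hne
  have hcount : u.Countable := hdisj.countable_of_isOpen
    (fun c _ => isOpen_cyl (ω := ω) c.1 c.2)
    fun c hc => hne c (huT hc)
  refine ⟨u, huT, hcount, hdisj, ?_⟩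
  have hM : 0 < 1 + 2 * τ := by linarith
  set big : ℝ × (EuclideanSpace ℝ (Fin n) × ℝ) → Set (EuclideanSpace ℝ (Fin n) × ℝ) :=
    fun c => cyl ω ((1 + 2 * τ) * c.1)
      (c.2.1, c.2.2 + τ / (1 + 2 * τ) * height ω ((1 + 2 * τ) * c.1) c.2.1)
  calc _ ≤ wMeasure ω (⋃ c ∈ u, big c) := by
        refine measure_mono (iUnion₂_subset fun a ha => ?_)
        obtain ⟨b, hb, hab, hle⟩ := hcov a ha
        exact (cyl_subset_dilation hn hω hτ (hpos b (huT hb)) (hpos a ha) hle hab).trans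
          (subset_biUnion_of_mem (u := big) hb)
    _ ≤ ∑' c : u, wMeasure ω (big c) := measure_biUnion_le _ hcount _
    _ ≤ ∑' c : u, ENNReal.ofReal ((1 + 2 * τ) ^ (n + 2) * K₀) *
          wMeasure ω (cyl ω c.1.1 c.1.2) := by
        refine ENNReal.tsum_le_tsum fun c => ?_
        have hc := hpos c (huT c.2)
        refine (wMeasure_cyl_le hn hK₀ hω hK (by positivity) _).trans ?_
        calc _ = ENNReal.ofReal ((1 + 2 * τ) ^ (n + 2) * K₀) *
              ENNReal.ofReal (unitBallVolume n * c.1.1 ^ (n + 2)) := by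
              rw [← ENNReal.ofReal_mul (by positivity)]
              congr 1
              rw [mul_pow]
              ring
          _ ≤ _ := by
              gcongr
              exact le_wMeasure_cyl hn hω hc _
    _ = _ := ENNReal.tsum_mul_left

/-! ### Density theorem -/

lemma exists_small_cyl_subset (hn : 1 ≤ n) (hω : IsAp (1 + 1 / (n : ℝ)) ω)
    {O : Set (EuclideanSpace ℝ (Fin n) × ℝ)} (hO : IsOpen O) {Y : EuclideanSpace ℝ (Fin n) × ℝ}
    (hY : Y ∈ O) :
    ∃ ρ, 0 < ρ ∧ ρ ≤ 1 ∧ cyl ω ρ (Y.1, Y.2 + height ω ρ Y.1 / 2) ⊆ O := by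
  obtain ⟨ε, hε, hball⟩ := Metric.isOpen_iff.1 hO Y hY
  have h1 := height_pos hn hω Y.1 one_pos
  -- Since `h_ρ ≤ ρ h_1` for `ρ ≤ 1`, the last entry makes the height at most `ε`; the entry `1`
  -- keeps radii bounded for the Vitali lemma.
  refine ⟨min (min ε 1) (ε / height ω 1 Y.1), by positivity,
    (min_le_left _ _).trans (min_le_right _ _), ?_⟩
  set ρ := min (min ε 1) (ε / height ω 1 Y.1) with hρdef
  have hρ : 0 < ρ := by positivity
  have hρε : ρ ≤ ε := (min_le_left _ _).trans (min_le_left _ _)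
  have hρ1 : ρ ≤ 1 := (min_le_left _ _).trans (min_le_right _ _)
  have hh : height ω ρ Y.1 ≤ ε := by
    have h2 := mul_height_le hn hω (x := Y.1) (x' := Y.1) one_pos hρ (by rw [dist_self]; linarith)
    have h3 : ρ * height ω 1 Y.1 ≤ ε := (le_div_iff₀ h1).1 (min_le_right _ _)
    linarith
  refine Subset.trans ?_ hball
  rw [← Prod.mk.eta (p := Y), ← ball_prod_same, Real.ball_eq_Ioo]
  exact prod_mono (Metric.ball_subset_ball hρε)
    (Ioo_subset_Ioo (by simp only; linarith) (by simp only; linarith))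

lemma one_sub_mul_le_wMeasure_diff (hω : IsAp (1 + 1 / (n : ℝ)) ω) {q : ℝ}
    (hq : q ∈ Ioo (0 : ℝ) 1) {D : Set (EuclideanSpace ℝ (Fin n) × ℝ)} {ρ : ℝ}
    {X : EuclideanSpace ℝ (Fin n) × ℝ}
    (h : wMeasure ω (cyl ω ρ X ∩ D) ≤ ENNReal.ofReal q * wMeasure ω (cyl ω ρ X)) :
    ENNReal.ofReal (1 - q) * wMeasure ω (cyl ω ρ X) ≤ wMeasure ω (cyl ω ρ X \ D) := by
  have hfin : ENNReal.ofReal q * wMeasure ω (cyl ω ρ X) ≠ ∞ :=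
    ENNReal.mul_ne_top ENNReal.ofReal_ne_top (wMeasure_cyl_lt_top hω ρ X).ne
  refine (ENNReal.add_le_add_iff_left hfin).1 ?_
  rw [← add_mul, ← ENNReal.ofReal_add hq.1.le (by linarith [hq.2]), add_sub_cancel,
    ENNReal.ofReal_one, one_mul]
  exact (measure_le_inter_add_sdiff _ _ D).trans (by gcongr)

/-- Density theorem: almost every point of `Γ` lies in a shrunken cylinder of the family. -/
lemma wMeasure_diff_setTilde (hn : 1 ≤ n) (hK₀ : 1 ≤ K₀) (hω : IsAp (1 + 1 / (n : ℝ)) ω)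
    (hK : apConst (1 + 1 / (n : ℝ)) ω ≤ ENNReal.ofReal K₀)
    {U Γ : Set (EuclideanSpace ℝ (Fin n) × ℝ)} (hU : IsOpen U) (hΓ : NullMeasurableSet Γ volume)
    (hΓU : Γ ⊆ U) (hfin : wMeasure ω Γ ≠ ∞) {q η : ℝ} (hq : q ∈ Ioo (0 : ℝ) 1) (hη : 0 < η) :
    wMeasure ω (Γ \ setTilde ω U Γ q η) = 0 := by
  have := isLocallyFiniteMeasure_wMeasure hω
  set D := Γ \ setTilde ω U Γ q η with hD
  have hDm : NullMeasurableSet D (wMeasure ω) :=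
    (hΓ.mono_ac wMeasure_absolutelyContinuous).diff
      (isOpen_setTilde U Γ q η).measurableSet.nullMeasurableSet
  have hDfin : wMeasure ω D ≠ ∞ := ((measure_mono sdiff_subset).trans_lt hfin.lt_top).ne
  set κ := ENNReal.ofReal ((1 + 2 * 2) ^ (n + 2) * K₀)
  have key : ∀ ε : ℝ≥0∞, 0 < ε → ENNReal.ofReal (1 - q) * wMeasure ω D ≤ κ * ε := by
    intro ε hε
    obtain ⟨O, hDO, hO, hOε⟩ := D.exists_isOpen_lt_add hDfin hε.ne'
    choose! r hr0 hr1 hrO using fun Y (hY : Y ∈ O ∩ U) =>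
      exists_small_cyl_subset hn hω (hO.inter hU) hY
    have hDOU : D ⊆ O ∩ U := subset_inter hDO (sdiff_subset.trans hΓU)
    set f : EuclideanSpace ℝ (Fin n) × ℝ → ℝ × (EuclideanSpace ℝ (Fin n) × ℝ) :=
      fun Y => (r Y, (Y.1, Y.2 + height ω (r Y) Y.1 / 2)) with hf
    obtain ⟨u, huT, hcount, hdisj, hle⟩ := exists_disjoint_cyl hn hK₀ hω hK (f '' D)
      (by rintro _ ⟨Y, hY, rfl⟩; exact hr0 Y (hDOU hY)) 1
      (by rintro _ ⟨Y, hY, rfl⟩; exact hr1 Y (hDOU hY)) one_lt_two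
    have hcovD : D ⊆ ⋃ c ∈ f '' D, cyl ω c.1 c.2 := by
      intro Y hY
      have hh := height_pos hn hω Y.1 (hr0 Y (hDOU hY))
      refine mem_biUnion (mem_image_of_mem f hY) ⟨Metric.mem_ball_self (hr0 Y (hDOU hY)), ?_⟩
      constructor <;> simp only [hf] <;> linarith
    have hdens : ∀ c ∈ f '' D, ENNReal.ofReal (1 - q) * wMeasure ω (cyl ω c.1 c.2) ≤
        (wMeasure ω).restrict Dᶜ (cyl ω c.1 c.2) := by
      rintro _ ⟨Y, hY, rfl⟩
      rw [Measure.restrict_apply (isOpen_cyl _ _).measurableSet, ← sdiff_eq]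
      refine one_sub_mul_le_wMeasure_diff hω hq ?_
      have hYr := hr0 Y (hDOU hY)
      have hh := height_pos hn hω Y.1 hYr
      -- Density of `D` above `q` would put the cylinder in the family, and its shrunken copy still
      -- contains `Y`, which was assumed uncovered.
      by_contra! hcon
      refine hY.2 (mem_biUnion (x := f Y) ⟨hYr, (hrO Y (hDOU hY)).trans inter_subset_right, ?_⟩ ?_)
      · exact hcon.le.trans (measure_mono (inter_subset_inter_right _ sdiff_subset))
      · refine ⟨Metric.mem_ball_self (mul_pos hη hYr), ?_⟩
        constructor <;> simp only [hf] <;> linarith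
    calc ENNReal.ofReal (1 - q) * wMeasure ω D
        ≤ ENNReal.ofReal (1 - q) * (κ * ∑' c : u, wMeasure ω (cyl ω c.1.1 c.1.2)) := by
          gcongr
          exact (measure_mono hcovD).trans hle
      _ = κ * ∑' c : u, ENNReal.ofReal (1 - q) * wMeasure ω (cyl ω c.1.1 c.1.2) := by
          rw [ENNReal.tsum_mul_left]
          ring
      _ ≤ κ * ∑' c : u, (wMeasure ω).restrict Dᶜ (cyl ω c.1.1 c.1.2) := by
          gcongr with c
          exact hdens c (huT c.2)
      _ = κ * (wMeasure ω).restrict Dᶜ (⋃ c ∈ u, cyl ω c.1 c.2) := by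
          rw [measure_biUnion hcount hdisj fun c _ => (isOpen_cyl _ _).measurableSet]
      _ ≤ κ * wMeasure ω (O \ D) := by
          gcongr κ * ?_
          rw [Measure.restrict_apply (.biUnion hcount fun c _ => (isOpen_cyl _ _).measurableSet),
            sdiff_eq]
          refine measure_mono (inter_subset_inter_left _ (iUnion₂_subset fun c hc => ?_))
          obtain ⟨Y, hY, rfl⟩ := huT hc
          exact (hrO Y (hDOU hY)).trans inter_subset_left
      _ ≤ κ * ε := by
          gcongr
          rw [measure_sdiff hDO hDm hDfin]
          exact tsub_le_iff_left.2 hOε.le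
  have hlim : Filter.Tendsto (fun ε : ℝ≥0∞ => κ * ε) (nhdsWithin 0 (Ioi 0)) (nhds (κ * 0)) :=
    (ENNReal.Tendsto.const_mul Filter.tendsto_id (Or.inr ENNReal.ofReal_ne_top)).mono_left
      nhdsWithin_le_nhds
  have hzero := ge_of_tendsto hlim (Filter.eventually_of_mem self_mem_nhdsWithin key)
  rw [mul_zero, nonpos_iff_eq_zero, mul_eq_zero, ENNReal.ofReal_eq_zero] at hzero
  exact hzero.resolve_left (by linarith [hq.2])

/-! ### Enlarging a cylinder to density exactly `q` -/

lemma dist_add_le_of_ball_subset_ball {E : Type*} [NormedAddCommGroup E] [NormedSpace ℝ E]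
    [Nontrivial E] {x : E} {ρ r : ℝ} (hρ : 0 < ρ)
    (h : Metric.ball x ρ ⊆ Metric.ball 0 r) : ‖x‖ + ρ ≤ r := by
  by_contra! hcon
  obtain ⟨e, he, hxe⟩ : ∃ e : E, ‖e‖ = 1 ∧ x = ‖x‖ • e := by
    rcases eq_or_ne x 0 with rfl | hx
    · obtain ⟨e, he⟩ := NormedSpace.exists_lt_norm ℝ E 0
      exact ⟨‖e‖⁻¹ • e, by rw [norm_smul, norm_inv, norm_norm, inv_mul_cancel₀ he.ne'], by simp⟩
    · have hx' : ‖x‖ ≠ 0 := norm_ne_zero_iff.2 hx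
      exact ⟨‖x‖⁻¹ • x, by rw [norm_smul, norm_inv, norm_norm, inv_mul_cancel₀ hx'],
        by rw [smul_smul, mul_inv_cancel₀ hx', one_smul]⟩
  set t := max 0 (r - ‖x‖)
  have ht0 : 0 ≤ t := le_max_left _ _
  have ht : t < ρ := max_lt hρ (by linarith)
  have hmem : x + t • e ∈ Metric.ball x ρ := by
    rw [Metric.mem_ball, dist_eq_norm, add_sub_cancel_left, norm_smul, he, mul_one,
      Real.norm_of_nonneg ht0]
    exact ht
  have h2 := h hmem
  have hnorm : ‖x + t • e‖ = ‖x‖ + t := by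
    nth_rewrite 1 [hxe]
    rw [← add_smul, norm_smul, he, mul_one, Real.norm_of_nonneg (by positivity)]
  rw [mem_ball_zero_iff, hnorm] at h2
  have := le_max_right 0 (r - ‖x‖)
  linarith

section Continuity

variable {E : Type*} [PseudoMetricSpace E] {x : ℝ → E} {ρ a b : ℝ → ℝ}

lemma eventually_mem_ball_iff (hx : Continuous x) (hρ : Continuous ρ) {θ₀ : ℝ} {y : E}
    (hy : y ∉ Metric.sphere (x θ₀) (ρ θ₀)) :
    ∀ᶠ θ in nhds θ₀, (y ∈ Metric.ball (x θ) (ρ θ) ↔ y ∈ Metric.ball (x θ₀) (ρ θ₀)) := by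
  have hd : Continuous fun θ => dist y (x θ) := continuous_const.dist hx
  simp only [Metric.mem_ball]
  rcases lt_or_gt_of_ne hy with h | h
  · filter_upwards [hd.continuousAt.eventually_lt hρ.continuousAt h] with θ hθ
    exact iff_of_true hθ h
  · filter_upwards [hρ.continuousAt.eventually_lt hd.continuousAt h] with θ hθ
    exact iff_of_false hθ.not_gt h.not_gt

lemma eventually_mem_Ioo_iff (ha : Continuous a) (hb : Continuous b) {θ₀ t : ℝ}
    (hta : t ≠ a θ₀) (htb : t ≠ b θ₀) :
    ∀ᶠ θ in nhds θ₀, (t ∈ Ioo (a θ) (b θ) ↔ t ∈ Ioo (a θ₀) (b θ₀)) := by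
  have h1 : ∀ᶠ θ in nhds θ₀, (a θ < t ↔ a θ₀ < t) := by
    rcases lt_or_gt_of_ne hta with h | h
    · filter_upwards [continuousAt_const.eventually_lt ha.continuousAt h] with θ hθ
      exact iff_of_false hθ.not_gt h.not_gt
    · filter_upwards [ha.continuousAt.eventually_lt continuousAt_const h] with θ hθ
      exact iff_of_true hθ h
  have h2 : ∀ᶠ θ in nhds θ₀, (t < b θ ↔ t < b θ₀) := by
    rcases lt_or_gt_of_ne htb with h | h
    · filter_upwards [continuousAt_const.eventually_lt hb.continuousAt h] with θ hθ
      exact iff_of_true hθ h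
    · filter_upwards [hb.continuousAt.eventually_lt continuousAt_const h] with θ hθ
      exact iff_of_false hθ.not_gt h.not_gt
  filter_upwards [h1, h2] with θ h1 h2
  exact and_congr h1 h2

lemma eventually_ball_subset (hx : Continuous x) (hρ : Continuous ρ) (θ₀ : ℝ) :
    ∀ᶠ θ in nhds θ₀, Metric.ball (x θ) (ρ θ) ⊆ Metric.ball (x θ₀) (ρ θ₀ + 1) := by
  have hc : Continuous fun θ => ρ θ + dist (x θ) (x θ₀) := hρ.add (hx.dist continuous_const)
  have : ∀ᶠ θ in nhds θ₀, ρ θ + dist (x θ) (x θ₀) < ρ θ₀ + 1 :=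
    hc.continuousAt.eventually_lt continuousAt_const (by simp)
  filter_upwards [this] with θ hθ
  exact Metric.ball_subset_ball' hθ.le

end Continuity

/-- Indicators of moving balls converge off the limiting sphere, which is null; in dimension zero a
sphere of radius `0` would not be, hence `Nontrivial`. -/
lemma continuous_measure_ball [Nontrivial (EuclideanSpace ℝ (Fin n))]
    {μ : Measure (EuclideanSpace ℝ (Fin n))} (hμ : μ ≪ volume)
    (hfin : ∀ x r, μ (Metric.ball x r) < ∞) {x : ℝ → EuclideanSpace ℝ (Fin n)} {ρ : ℝ → ℝ}
    (hx : Continuous x) (hρ : Continuous ρ) :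
    Continuous fun θ => μ.real (Metric.ball (x θ) (ρ θ)) := by
  refine continuous_iff_continuousAt.2 fun θ₀ => ?_
  refine (ENNReal.tendsto_toReal (hfin _ _).ne).comp ?_
  refine tendsto_measure_of_ae_tendsto_indicator (nhds θ₀) measurableSet_ball
    (fun _ => measurableSet_ball) (B := Metric.ball (x θ₀) (ρ θ₀ + 1)) measurableSet_ball
    (hfin _ _).ne (eventually_ball_subset hx hρ θ₀) ?_
  have h : μ (Metric.sphere (x θ₀) (ρ θ₀)) = 0 := hμ (Measure.addHaar_sphere _ _ _)
  filter_upwards [measure_eq_zero_iff_ae_notMem.1 h] with y hy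
  exact eventually_mem_ball_iff hx hρ hy

lemma continuous_measure_ball_prod_Ioo [Nontrivial (EuclideanSpace ℝ (Fin n))]
    {μ : Measure (EuclideanSpace ℝ (Fin n) × ℝ)} (hμ : μ ≪ volume)
    (hfin : ∀ x r a b, μ (Metric.ball x r ×ˢ Ioo a b) < ∞) {x : ℝ → EuclideanSpace ℝ (Fin n)}
    {ρ a b : ℝ → ℝ} (hx : Continuous x) (hρ : Continuous ρ) (ha : Continuous a)
    (hb : Continuous b) :
    Continuous fun θ => μ.real (Metric.ball (x θ) (ρ θ) ×ˢ Ioo (a θ) (b θ)) := by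
  refine continuous_iff_continuousAt.2 fun θ₀ => ?_
  refine (ENNReal.tendsto_toReal (hfin _ _ _ _).ne).comp ?_
  refine tendsto_measure_of_ae_tendsto_indicator (nhds θ₀)
    (measurableSet_ball.prod measurableSet_Ioo) (fun _ => measurableSet_ball.prod measurableSet_Ioo)
    (B := Metric.ball (x θ₀) (ρ θ₀ + 1) ×ˢ Ioo (a θ₀ - 1) (b θ₀ + 1))
    (measurableSet_ball.prod measurableSet_Ioo) (hfin _ _ _ _).ne ?_ ?_
  · filter_upwards [eventually_ball_subset hx hρ θ₀,
      continuousAt_const.eventually_lt ha.continuousAt (sub_one_lt (a θ₀)),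
      hb.continuousAt.eventually_lt continuousAt_const (lt_add_one (b θ₀))] with θ h1 h2 h3
    exact prod_mono h1 (Ioo_subset_Ioo h2.le h3.le)
  · have h1 : μ (Metric.sphere (x θ₀) (ρ θ₀) ×ˢ univ) = 0 := hμ (by
      rw [Measure.volume_eq_prod, Measure.prod_prod, Measure.addHaar_sphere, zero_mul])
    have h2 : ∀ t : ℝ, μ (univ ×ˢ {t}) = 0 := fun t => hμ (by
      rw [Measure.volume_eq_prod, Measure.prod_prod, Real.volume_singleton, mul_zero])
    filter_upwards [measure_eq_zero_iff_ae_notMem.1 h1, measure_eq_zero_iff_ae_notMem.1 (h2 (a θ₀)),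
      measure_eq_zero_iff_ae_notMem.1 (h2 (b θ₀))] with Y hY1 hY2 hY3
    simp only [mem_prod, mem_univ, and_true, true_and, mem_singleton_iff] at hY1 hY2 hY3
    filter_upwards [eventually_mem_ball_iff hx hρ hY1,
      eventually_mem_Ioo_iff ha hb hY2 hY3] with θ h1 h2
    exact and_congr h1 h2

lemma continuous_slope [Nontrivial (EuclideanSpace ℝ (Fin n))] (hn : 1 ≤ n)
    (hω : IsAp (1 + 1 / (n : ℝ)) ω) {x : ℝ → EuclideanSpace ℝ (Fin n)} {ρ : ℝ → ℝ}
    (hx : Continuous x) (hρ : Continuous ρ) : Continuous fun θ => slope ω (ρ θ) (x θ) :=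
  ((continuous_measure_ball (withDensity_absolutelyContinuous _ _)
    (dualWeight_ball_lt_top hn hω) hx hρ).div_const _).rpow_const fun _ => Or.inr (by positivity)

lemma cyl_subset_cyl_zero [Nontrivial (EuclideanSpace ℝ (Fin n))] (hn : 1 ≤ n)
    (hω : IsAp (1 + 1 / (n : ℝ)) ω) {ρ r : ℝ} (hρ : 0 < ρ) {X : EuclideanSpace ℝ (Fin n) × ℝ}
    (h : cyl ω ρ X ⊆ cyl ω r 0) :
    ‖X.1‖ + ρ ≤ r ∧ X.2 ≤ 0 ∧ height ω ρ X.1 - height ω r 0 ≤ X.2 := by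
  have hh := height_pos hn hω X.1 hρ
  rcases prod_subset_prod_iff.1 h with ⟨h1, h2⟩ | h1 | h1
  · rw [Ioo_subset_Ioo_iff (by linarith)] at h2
    simp only [Prod.snd_zero, Prod.fst_zero] at h1 h2
    exact ⟨dist_add_le_of_ball_subset_ball hρ h1, h2.2, by linarith [h2.1]⟩
  · exact absurd h1 (Metric.nonempty_ball.2 hρ).ne_empty
  · exact absurd h1 (nonempty_Ioo.2 (by linarith)).ne_empty

/-- A cylinder of density at least `q` in a large cylinder of density at most `q` can be enlarged
to one of density exactly `q`. -/
lemma exists_cyl_density_eq (hn : 1 ≤ n) (hω : IsAp (1 + 1 / (n : ℝ)) ω) {r : ℝ}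
    {Γ : Set (EuclideanSpace ℝ (Fin n) × ℝ)} {q : ℝ} (hq : q ∈ Ioo (0 : ℝ) 1)
    (hΓ : wMeasure ω (cyl ω r 0 ∩ Γ) ≤ ENNReal.ofReal q * wMeasure ω (cyl ω r 0))
    {c₀ : ℝ × (EuclideanSpace ℝ (Fin n) × ℝ)} (hc₀ : c₀ ∈ family ω (cyl ω r 0) Γ q) :
    ∃ c : ℝ × (EuclideanSpace ℝ (Fin n) × ℝ), 0 < c.1 ∧ c.1 ≤ r ∧
      cyl ω c₀.1 c₀.2 ⊆ cyl ω c.1 c.2 ∧ cyl ω c.1 c.2 ⊆ cyl ω r 0 ∧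
      wMeasure ω (cyl ω c.1 c.2 ∩ Γ) = ENNReal.ofReal q * wMeasure ω (cyl ω c.1 c.2) := by
  have : Nonempty (Fin n) := ⟨⟨0, hn⟩⟩
  obtain ⟨ρ₀, x₀, s₀⟩ := c₀
  obtain ⟨hρ₀, hsub, hdens⟩ := hc₀
  simp only at hρ₀ hsub hdens
  obtain ⟨hxr, hs0, hs1⟩ := cyl_subset_cyl_zero hn hω hρ₀ hsub
  simp only at hxr hs0 hs1
  set x : ℝ → EuclideanSpace ℝ (Fin n) := fun θ => (1 - θ) • x₀ with hxdef
  set ρ : ℝ → ℝ := fun θ => (1 - θ) * ρ₀ + θ * r with hρdef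
  set H : ℝ → ℝ := fun θ => ρ θ * slope ω (ρ θ) (x θ) with hHdef
  -- The top stays at `s₀` until the growing cylinder would drop below the floor of the large one,
  -- then rises with the height. This starts at the given cylinder, ends at the large one, and keeps
  -- every stage between them.
  set s : ℝ → ℝ := fun θ => max s₀ (H θ - height ω r 0) with hsdef
  have hxc : Continuous x := by fun_prop
  have hρc : Continuous ρ := by fun_prop
  have hHc : Continuous H := hρc.mul (continuous_slope hn hω hxc hρc)
  have hsc : Continuous s := continuous_const.max (hHc.sub continuous_const)
  set C : ℝ → Set (EuclideanSpace ℝ (Fin n) × ℝ) :=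
    fun θ => Metric.ball (x θ) (ρ θ) ×ˢ Ioo (s θ - H θ) (s θ) with hCdef
  have hρ₀r : ρ₀ ≤ r := by linarith [norm_nonneg x₀]
  have hρpos : ∀ θ ∈ Icc (0 : ℝ) 1, 0 < ρ θ := fun θ hθ => by
    simp only [hρdef]
    nlinarith [hθ.1, hθ.2]
  have hH : ∀ θ ∈ Icc (0 : ℝ) 1, H θ = height ω (ρ θ) (x θ) := fun θ hθ =>
    (height_eq hn hω _ (hρpos θ hθ)).symm
  have hC : ∀ θ ∈ Icc (0 : ℝ) 1, C θ = cyl ω (ρ θ) (x θ, s θ) := fun θ hθ => by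
    simp only [hCdef, cyl, hH θ hθ]
  have hC0 : C 0 = cyl ω ρ₀ (x₀, s₀) := by
    rw [hC 0 (by simp)]
    have e1 : x 0 = x₀ := by simp [hxdef]
    have e2 : ρ 0 = ρ₀ := by simp [hρdef]
    have e3 : s 0 = s₀ := by
      simp only [hsdef]
      rw [hH 0 (by simp), e1, e2]
      exact max_eq_left hs1
    rw [e1, e2, e3]
  have hC1 : C 1 = cyl ω r 0 := by
    rw [hC 1 (by simp)]
    have e1 : x 1 = 0 := by simp [hxdef]
    have e2 : ρ 1 = r := by simp [hρdef]
    have e3 : s 1 = 0 := by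
      simp only [hsdef]
      rw [hH 1 (by simp), e1, e2, sub_self]
      exact max_eq_right hs0
    rw [e1, e2, e3]
    rfl
  have hac : (wMeasure ω).restrict Γ ≪ volume :=
    Measure.absolutelyContinuous_of_le Measure.restrict_le_self |>.trans
      wMeasure_absolutelyContinuous
  have hfin : ∀ (y : EuclideanSpace ℝ (Fin n)) (R a b : ℝ),
      wMeasure ω (Metric.ball y R ×ˢ Ioo a b) < ∞ := fun y R a b => by
    rw [wMeasure_ball_prod_Ioo hω]
    exact ENNReal.mul_lt_top (weight_ball_lt_top hω _ _) ENNReal.ofReal_lt_top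
  have hF : Continuous fun θ => ((wMeasure ω).restrict Γ).real (C θ) -
      q * (wMeasure ω).real (C θ) :=
    (continuous_measure_ball_prod_Ioo hac
      (fun y R a b => (Measure.restrict_apply_le _ _).trans_lt (hfin y R a b)) hxc hρc
      (hsc.sub hHc) hsc).sub
    (continuous_const.mul (continuous_measure_ball_prod_Ioo wMeasure_absolutelyContinuous hfin
      hxc hρc (hsc.sub hHc) hsc))
  have hreal : ∀ ρ' X, ((wMeasure ω).restrict Γ).real (cyl ω ρ' X) =
      (wMeasure ω).real (cyl ω ρ' X ∩ Γ) := fun ρ' X => by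
    rw [measureReal_def, Measure.restrict_apply (isOpen_cyl _ _).measurableSet, measureReal_def]
  have hqreal : ∀ ρ' X, q * (wMeasure ω).real (cyl ω ρ' X) =
      (ENNReal.ofReal q * wMeasure ω (cyl ω ρ' X)).toReal := fun ρ' X => by
    rw [ENNReal.toReal_mul, ENNReal.toReal_ofReal hq.1.le, measureReal_def]
  have hqfin : ∀ ρ' X, ENNReal.ofReal q * wMeasure ω (cyl ω ρ' X) ≠ ∞ := fun ρ' X =>
    ENNReal.mul_ne_top ENNReal.ofReal_ne_top (wMeasure_cyl_lt_top hω _ _).ne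
  have hΓfin : ∀ ρ' X, wMeasure ω (cyl ω ρ' X ∩ Γ) ≠ ∞ := fun ρ' X =>
    ((measure_mono inter_subset_left).trans_lt (wMeasure_cyl_lt_top hω ρ' X)).ne
  -- The excess of `Γ`-mass over `q` times the total mass is nonnegative at `θ = 0` and nonpositive
  -- at `θ = 1`.
  obtain ⟨θ, hθ, hθ0⟩ := intermediate_value_Icc' zero_le_one hF.continuousOn
    (show (0 : ℝ) ∈ Icc _ _ by
      rw [hC0, hC1, hreal, hreal, hqreal, hqreal, measureReal_def, measureReal_def]
      exact ⟨sub_nonpos.2 (ENNReal.toReal_mono (hqfin _ _) hΓ),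
        sub_nonneg.2 (ENNReal.toReal_mono (hΓfin _ _) hdens)⟩)
  simp only [hC θ hθ] at hθ0
  rw [hreal, hqreal, measureReal_def, sub_eq_zero,
    ENNReal.toReal_eq_toReal_iff' (hΓfin _ _) (hqfin _ _)] at hθ0
  have hx0 : dist x₀ (x θ) = θ * ‖x₀‖ := by
    rw [dist_eq_norm, show x₀ - x θ = θ • x₀ by simp only [hxdef]; module, norm_smul,
      Real.norm_of_nonneg hθ.1]
  have hxr' : dist (x θ) 0 = (1 - θ) * ‖x₀‖ := by
    rw [dist_zero_right, norm_smul, Real.norm_of_nonneg (by linarith [hθ.2])]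
  have hin : dist x₀ (x θ) + ρ₀ ≤ ρ θ := by
    rw [hx0]
    simp only [hρdef]
    nlinarith [hθ.1, mul_le_mul_of_nonneg_left hxr hθ.1]
  have hout : dist (x θ) 0 + ρ θ ≤ r := by
    rw [hxr']
    simp only [hρdef]
    nlinarith [mul_le_mul_of_nonneg_left hxr (sub_nonneg.2 hθ.2)]
  have hh0 := height_mono hn hω hρ₀ hin
  have hh1 := height_mono hn hω (hρpos θ hθ) hout
  rw [← hH θ hθ] at hh0 hh1
  refine ⟨(ρ θ, (x θ, s θ)), hρpos θ hθ, ?_, ?_, ?_, hθ0⟩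
  · linarith [dist_nonneg (x := x θ) (y := 0)]
  · refine prod_mono (Metric.ball_subset_ball' (by linarith)) (Ioo_subset_Ioo ?_ (le_max_left _ _))
    simp only
    rw [← hH θ hθ, sub_le_iff_le_add]
    exact max_le (by linarith) (by linarith)
  · refine prod_mono (Metric.ball_subset_ball' ?_) (Ioo_subset_Ioo ?_ ?_)
    · simp only [Prod.fst_zero]
      linarith
    · simp only [Prod.fst_zero, Prod.snd_zero]
      rw [← hH θ hθ]
      linarith [le_max_right s₀ (H θ - height ω r 0)]
    · exact (max_le hs0 (by linarith) : s θ ≤ 0)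

/-! ### Growth estimate: the factor `ξ₀` -/

lemma wMeasure_cyl_diff_cylTilde_le (hn : 1 ≤ n) (hK₀ : 1 ≤ K₀) (hω : IsAp (1 + 1 / (n : ℝ)) ω)
    (hK : apConst (1 + 1 / (n : ℝ)) ω ≤ ENNReal.ofReal K₀) {ρ η : ℝ} (hρ : 0 < ρ)
    (hη : η ∈ Ioo (0 : ℝ) 1) (X : EuclideanSpace ℝ (Fin n) × ℝ) :
    wMeasure ω (cyl ω ρ X \ cylTilde ω η ρ X) ≤
      ENNReal.ofReal ((decayFactor n K₀)⁻¹ * (1 - η ^ n) ^ decayExponent n K₀) *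
        wMeasure ω (cyl ω ρ X) := by
  have hb := ENNReal.ofReal_le_ofReal (weight_ball_diff_le hn hK₀ hω hK X.1 hρ hη)
  have hnn : 0 ≤ (decayFactor n K₀)⁻¹ * (1 - η ^ n) ^ decayExponent n K₀ :=
    mul_nonneg (inv_nonneg.2 (decayFactor_pos hK₀).le)
      (Real.rpow_nonneg (sub_nonneg.2 (pow_le_one₀ hη.1.le hη.2.le)) _)
  rw [ENNReal.ofReal_mul hnn, ofReal_measureReal
      ((measure_mono sdiff_subset).trans_lt (weight_ball_lt_top hω X.1 ρ)).ne,
    ofReal_measureReal (weight_ball_lt_top hω _ _).ne] at hb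
  have hset : cyl ω ρ X \ cylTilde ω η ρ X =
      (Metric.ball X.1 ρ \ Metric.ball X.1 (η * ρ)) ×ˢ Ioo (X.2 - height ω ρ X.1) X.2 := by
    ext Y
    simp only [cyl, cylTilde, mem_sdiff, mem_prod]
    tauto
  rw [hset, wMeasure_eq_prod hω, Measure.prod_prod, cyl, Measure.prod_prod, ← mul_assoc]
  gcongr

/-- At least the fraction `1 - q` of the cylinder avoids `Γ`; even if all the mass lost in shrinking
is taken from that part, the stated gain survives. -/
lemma wMeasure_cylTilde_diff_ge (hn : 1 ≤ n) (hK₀ : 1 ≤ K₀) (hω : IsAp (1 + 1 / (n : ℝ)) ω)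
    (hK : apConst (1 + 1 / (n : ℝ)) ω ≤ ENNReal.ofReal K₀)
    {Γ : Set (EuclideanSpace ℝ (Fin n) × ℝ)} {q η : ℝ} (hq : q ∈ Ioo (0 : ℝ) 1)
    (hη : η ∈ Ioo (0 : ℝ) 1)
    (hgain : 0 ≤ 1 - q - (decayFactor n K₀)⁻¹ * (1 - η ^ n) ^ decayExponent n K₀)
    {ρ : ℝ} (hρ : 0 < ρ) {X : EuclideanSpace ℝ (Fin n) × ℝ}
    (hX : wMeasure ω (cyl ω ρ X ∩ Γ) ≤ ENNReal.ofReal q * wMeasure ω (cyl ω ρ X)) :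
    ENNReal.ofReal (1 - q - (decayFactor n K₀)⁻¹ * (1 - η ^ n) ^ decayExponent n K₀) *
      wMeasure ω (cyl ω ρ X) ≤ wMeasure ω (cylTilde ω η ρ X \ Γ) := by
  have hloss := wMeasure_cyl_diff_cylTilde_le hn hK₀ hω hK hρ hη X
  set δ := (decayFactor n K₀)⁻¹ * (1 - η ^ n) ^ decayExponent n K₀ with hδ
  have hδ0 : 0 ≤ δ := mul_nonneg (inv_nonneg.2 (decayFactor_pos hK₀).le)
    (Real.rpow_nonneg (sub_nonneg.2 (pow_le_one₀ hη.1.le hη.2.le)) _)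
  have hfin : ENNReal.ofReal δ * wMeasure ω (cyl ω ρ X) ≠ ∞ :=
    ENNReal.mul_ne_top ENNReal.ofReal_ne_top (wMeasure_cyl_lt_top hω ρ X).ne
  refine (ENNReal.add_le_add_iff_right hfin).1 ?_
  rw [← add_mul, ← ENNReal.ofReal_add hgain hδ0, sub_add_cancel]
  calc _ ≤ wMeasure ω (cyl ω ρ X \ Γ) := one_sub_mul_le_wMeasure_diff hω hq hX
    _ ≤ wMeasure ω (cylTilde ω η ρ X \ Γ ∪ cyl ω ρ X \ cylTilde ω η ρ X) := by
        refine measure_mono fun Y hY => ?_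
        by_cases hYt : Y ∈ cylTilde ω η ρ X
        · exact Or.inl ⟨hYt, hY.2⟩
        · exact Or.inr ⟨hY.1, hYt⟩
    _ ≤ _ := (measure_union_le _ _).trans (by gcongr)

lemma cylTilde_subset_cyl {ρ η : ℝ} (hρ : 0 < ρ) (hη : η ∈ Ioo (0 : ℝ) 1)
    (X : EuclideanSpace ℝ (Fin n) × ℝ) : cylTilde ω η ρ X ⊆ cyl ω ρ X :=
  prod_mono (Metric.ball_subset_ball (by nlinarith [hη.2])) Subset.rfl

/-- The growth estimate with the Vitali constant `(1 + 2τ) ^ (n + 2)`, `τ > 1`. -/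
lemma growth_of_one_lt (hn : 1 ≤ n) (hK₀ : 1 ≤ K₀) (hω : IsAp (1 + 1 / (n : ℝ)) ω)
    (hK : apConst (1 + 1 / (n : ℝ)) ω ≤ ENNReal.ofReal K₀) {r : ℝ}
    {Γ : Set (EuclideanSpace ℝ (Fin n) × ℝ)} (hΓ : NullMeasurableSet Γ volume)
    (hΓr : Γ ⊆ cyl ω r 0) {q η : ℝ} (hq : q ∈ Ioo (0 : ℝ) 1) (hη : η ∈ Ioo (0 : ℝ) 1)
    (hsmall : wMeasure ω Γ ≤ ENNReal.ofReal q * wMeasure ω (cyl ω r 0))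
    (hgain : 0 ≤ 1 - q - (decayFactor n K₀)⁻¹ * (1 - η ^ n) ^ decayExponent n K₀)
    {τ : ℝ} (hτ : 1 < τ) :
    ENNReal.ofReal (1 + (1 - q - (decayFactor n K₀)⁻¹ * (1 - η ^ n) ^ decayExponent n K₀) /
      ((1 + 2 * τ) ^ (n + 2) * K₀)) * wMeasure ω Γ ≤
    wMeasure ω (setTilde ω (cyl ω r 0) Γ q η) := by
  have hΓfin : wMeasure ω Γ ≠ ∞ := ((measure_mono hΓr).trans_lt (wMeasure_cyl_lt_top hω r 0)).ne
  have hnull := wMeasure_diff_setTilde hn hK₀ hω hK (isOpen_cyl r 0) hΓ hΓr hΓfin hq hη.1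
  have hΓm := hΓ.mono_ac (wMeasure_absolutelyContinuous (ω := ω))
  have hpt : ∀ ρ, 0 < ρ → ∀ X,
      wMeasure ω (cyl ω ρ X ∩ Γ) ≤ ENNReal.ofReal q * wMeasure ω (cyl ω ρ X) → _ :=
    fun ρ hρ X => wMeasure_cylTilde_diff_ge hn hK₀ hω hK (Γ := Γ) (X := X) hq hη hgain hρ
  set a := 1 - q - (decayFactor n K₀)⁻¹ * (1 - η ^ n) ^ decayExponent n K₀
  set M := (1 + 2 * τ) ^ (n + 2) * K₀ with hM
  have hMpos : 0 < M := by
    have : 0 < 1 + 2 * τ := by linarith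
    positivity
  set F := setTilde ω (cyl ω r 0) Γ q η with hF
  -- Exact density serves twice: `≥ q` keeps these cylinders in the family, so their shrunken copies
  -- lie in `F`, while `≤ q` leaves mass outside `Γ`.
  set T : Set (ℝ × (EuclideanSpace ℝ (Fin n) × ℝ)) := {c | 0 < c.1 ∧ c.1 ≤ r ∧
    cyl ω c.1 c.2 ⊆ cyl ω r 0 ∧
    wMeasure ω (cyl ω c.1 c.2 ∩ Γ) = ENNReal.ofReal q * wMeasure ω (cyl ω c.1 c.2)} with hT
  obtain ⟨u, huT, hcount, hdisj, hle⟩ := exists_disjoint_cyl hn hK₀ hω hK T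
    (fun c hc => hc.1) r (fun c hc => hc.2.1) hτ
  have hdisj' : u.PairwiseDisjoint fun c => cylTilde ω η c.1 c.2 :=
    hdisj.mono_on fun c hc => cylTilde_subset_cyl (huT hc).1 hη c.2
  have hm : ∀ c ∈ u, MeasurableSet (cylTilde ω η c.1 c.2) := fun c _ =>
    (isOpen_cylTilde _ _ _).measurableSet
  have hΓcap : wMeasure ω Γ ≤ wMeasure ω (F ∩ Γ) := by
    have := measure_le_inter_add_sdiff (wMeasure ω) Γ F
    rwa [hnull, add_zero, inter_comm] at this
  have hcov : F ⊆ ⋃ c ∈ T, cyl ω c.1 c.2 := by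
    refine iUnion₂_subset fun c hc => ?_
    obtain ⟨c', h1, h2, h3, h4, h5⟩ := exists_cyl_density_eq hn hω hq
      ((measure_mono inter_subset_right).trans hsmall) hc
    refine (cylTilde_subset_cyl hc.1 hη c.2).trans (h3.trans ?_)
    exact subset_biUnion_of_mem (u := fun c : ℝ × (EuclideanSpace ℝ (Fin n) × ℝ) =>
      cyl ω c.1 c.2) (show c' ∈ T from ⟨h1, h2, h4, h5⟩)
  have houter : ENNReal.ofReal a * ∑' c : u, wMeasure ω (cyl ω c.1.1 c.1.2) ≤
      wMeasure ω (F \ Γ) := by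
    calc _ = ∑' c : u, ENNReal.ofReal a * wMeasure ω (cyl ω c.1.1 c.1.2) :=
          ENNReal.tsum_mul_left.symm
      _ ≤ ∑' c : u, (wMeasure ω).restrict Γᶜ (cylTilde ω η c.1.1 c.1.2) := by
          refine ENNReal.tsum_le_tsum fun c => ?_
          have hc := huT c.2
          rw [Measure.restrict_apply (hm c c.2), ← sdiff_eq]
          exact hpt _ hc.1 _ hc.2.2.2.le
      _ = (wMeasure ω).restrict Γᶜ (⋃ c ∈ u, cylTilde ω η c.1 c.2) :=
          (measure_biUnion hcount hdisj' hm).symm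
      _ ≤ _ := by
          rw [Measure.restrict_apply (.biUnion hcount hm), ← sdiff_eq]
          refine measure_mono (sdiff_subset_sdiff_left (iUnion₂_subset fun c hc => ?_))
          have hc' := huT hc
          exact subset_biUnion_of_mem (u := fun c : ℝ × (EuclideanSpace ℝ (Fin n) × ℝ) =>
            cylTilde ω η c.1 c.2) (show c ∈ family ω (cyl ω r 0) Γ q from
              ⟨hc'.1, hc'.2.2.1, hc'.2.2.2.ge⟩)
  rw [ENNReal.ofReal_add one_pos.le (by positivity), ENNReal.ofReal_one, add_mul, one_mul,
    ← measure_inter_add_sdiff₀ F hΓm]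
  refine add_le_add hΓcap (le_trans ?_ houter)
  calc _ ≤ ENNReal.ofReal (a / M) *
        (ENNReal.ofReal M * ∑' c : u, wMeasure ω (cyl ω c.1.1 c.1.2)) := by
        gcongr
        exact hΓcap.trans ((measure_mono (inter_subset_left.trans hcov)).trans hle)
    _ = _ := by
        rw [← mul_assoc, ← ENNReal.ofReal_mul (by positivity), div_mul_cancel₀ _ hMpos.ne']

/-- For nonnegative gain let `τ` decrease to `1` in `growth_of_one_lt`. For negative gain `ξ₀ ≤ 1`,
and the density theorem alone suffices. -/
lemma xi0_mul_le (hn : 1 ≤ n) (hK₀ : 1 ≤ K₀) (hω : IsAp (1 + 1 / (n : ℝ)) ω)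
    (hK : apConst (1 + 1 / (n : ℝ)) ω ≤ ENNReal.ofReal K₀) {r : ℝ}
    {Γ : Set (EuclideanSpace ℝ (Fin n) × ℝ)} (hΓ : NullMeasurableSet Γ volume)
    (hΓr : Γ ⊆ cyl ω r 0) {q η : ℝ} (hq : q ∈ Ioo (0 : ℝ) 1) (hη : η ∈ Ioo (0 : ℝ) 1)
    (hsmall : wMeasure ω Γ ≤ ENNReal.ofReal q * wMeasure ω (cyl ω r 0)) :
    ENNReal.ofReal (xi0 n K₀ (decayFactor n K₀)⁻¹ (decayExponent n K₀) q η) * wMeasure ω Γ ≤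
      wMeasure ω (setTilde ω (cyl ω r 0) Γ q η) := by
  have hΓfin : wMeasure ω Γ ≠ ∞ := ((measure_mono hΓr).trans_lt (wMeasure_cyl_lt_top hω r 0)).ne
  rcases le_or_gt 0 (1 - q - (decayFactor n K₀)⁻¹ * (1 - η ^ n) ^ decayExponent n K₀)
    with hgain | hgain
  · have hgrowth := fun τ (hτ : τ ∈ Ioi (1 : ℝ)) =>
      growth_of_one_lt hn hK₀ hω hK hΓ hΓr hq hη hsmall hgain hτ
    rw [xi0]
    set a := 1 - q - (decayFactor n K₀)⁻¹ * (1 - η ^ n) ^ decayExponent n K₀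
    have hcont : ContinuousAt (fun τ : ℝ => 1 + a / ((1 + 2 * τ) ^ (n + 2) * K₀)) 1 := by
      refine continuousAt_const.add (continuousAt_const.div (by fun_prop) ?_)
      positivity
    have hlim : Filter.Tendsto
        (fun τ : ℝ => ENNReal.ofReal (1 + a / ((1 + 2 * τ) ^ (n + 2) * K₀)) * wMeasure ω Γ)
        (nhdsWithin 1 (Ioi 1))
        (nhds (ENNReal.ofReal (1 + a / ((1 + 2 * 1) ^ (n + 2) * K₀)) * wMeasure ω Γ)) :=
      (ENNReal.Tendsto.mul_const (ENNReal.tendsto_ofReal hcont) (Or.inr hΓfin)).mono_left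
        nhdsWithin_le_nhds
    rw [show (1 + 2 * 1 : ℝ) = 3 by norm_num] at hlim
    exact le_of_tendsto hlim (Filter.eventually_of_mem self_mem_nhdsWithin hgrowth)
  · have hnull := wMeasure_diff_setTilde hn hK₀ hω hK (isOpen_cyl r 0) hΓ hΓr hΓfin hq hη.1
    have hxi : xi0 n K₀ (decayFactor n K₀)⁻¹ (decayExponent n K₀) q η ≤ 1 := by
      rw [xi0]
      linarith [div_nonpos_of_nonpos_of_nonneg hgain.le
        (show (0 : ℝ) ≤ 3 ^ (n + 2) * K₀ by positivity)]
    calc _ ≤ 1 * wMeasure ω Γ := by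
          gcongr
          exact ENNReal.ofReal_le_one.2 hxi
      _ = wMeasure ω Γ := one_mul _
      _ ≤ wMeasure ω (Γ ∩ setTilde ω (cyl ω r 0) Γ q η) +
          wMeasure ω (Γ \ setTilde ω (cyl ω r 0) Γ q η) := measure_le_inter_add_sdiff _ _ _
      _ ≤ _ := by
          rw [hnull, add_zero]
          exact measure_mono inter_subset_right

/-! ### From the large cylinder to all of space-time -/

lemma setTilde_mono {U V : Set (EuclideanSpace ℝ (Fin n) × ℝ)} (hUV : U ⊆ V)
    (Γ : Set (EuclideanSpace ℝ (Fin n) × ℝ)) (q η : ℝ) :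
    setTilde ω U Γ q η ⊆ setTilde ω V Γ q η :=
  biUnion_subset_biUnion_left fun _ hc => ⟨hc.1, hc.2.1.trans hUV, hc.2.2⟩

lemma cyl_zero_mono (hn : 1 ≤ n) (hω : IsAp (1 + 1 / (n : ℝ)) ω) {r R : ℝ} (hr : 0 < r)
    (hrR : r ≤ R) : cyl ω r 0 ⊆ cyl ω R 0 := by
  refine prod_mono (Metric.ball_subset_ball hrR) (Ioo_subset_Ioo ?_ le_rfl)
  exact sub_le_sub_left (height_mono hn hω hr (by rw [dist_self]; linarith)) _

/-- Sufficiently large cylinders centred at the origin have small density. -/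
lemma exists_large_cyl (hn : 1 ≤ n) (hω : IsAp (1 + 1 / (n : ℝ)) ω) (r : ℝ)
    {A : ℝ≥0∞} (hA : A ≠ ∞) {q : ℝ} (hq : 0 < q) :
    ∃ R, r ≤ R ∧ A ≤ ENNReal.ofReal q * wMeasure ω (cyl ω R 0) := by
  have hc := unitBallVolume_pos (n := n)
  -- The cylinder's measure is at least `c R^(n+2)`, hence at least `c R` once `R ≥ 1`; the last
  -- entry makes `q c R ≥ A`.
  set R := max (max r 1) (A.toReal / (q * unitBallVolume n)) with hR
  have hrR : r ≤ R := (le_max_left _ _).trans (le_max_left _ _)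
  have h1R : 1 ≤ R := (le_max_right _ _).trans (le_max_left _ _)
  have hAR : A.toReal ≤ R * (q * unitBallVolume n) :=
    (div_le_iff₀ (by positivity)).1 (le_max_right _ _)
  refine ⟨R, hrR, ?_⟩
  calc A = ENNReal.ofReal A.toReal := (ENNReal.ofReal_toReal hA).symm
    _ ≤ ENNReal.ofReal (q * (unitBallVolume n * R ^ (n + 2))) := by
        refine ENNReal.ofReal_le_ofReal (hAR.trans ?_)
        have : R ≤ R ^ (n + 2) := le_self_pow₀ h1R (by omega)
        calc _ = q * (unitBallVolume n * R) := by ring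
          _ ≤ _ := by gcongr
    _ ≤ _ := by
        rw [ENNReal.ofReal_mul hq.le]
        gcongr
        exact le_wMeasure_cyl hn hω (by linarith) _

end WeightedCovering

end

theorem lemma2p9 (n : ℕ) (hn : 1 ≤ n) (K₀ : ℝ) (hK₀ : 1 ≤ K₀) :
    ∃ N lam : ℝ, 0 < N ∧ 0 < lam ∧
      ∀ ω : EuclideanSpace ℝ (Fin n) → ℝ,
        WeightedCovering.IsAp (1 + 1 / (n : ℝ)) ω →
        WeightedCovering.apConst (1 + 1 / (n : ℝ)) ω ≤ ENNReal.ofReal K₀ →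
      ∀ r : ℝ, 0 < r →
      ∀ Γ : Set (EuclideanSpace ℝ (Fin n) × ℝ),
        NullMeasurableSet Γ volume → Γ ⊆ WeightedCovering.cyl ω r 0 →
      ∀ q η l : ℝ, q ∈ Ioo (0 : ℝ) 1 → η ∈ Ioo (0 : ℝ) 1 → 1 < l →
        -- the family of all weighted cylinders of density at least `q`
        (WeightedCovering.wMeasure ω (Γ \ WeightedCovering.setTilde ω univ Γ q η) = 0 ∧
          ENNReal.ofReal (WeightedCovering.xi0 n K₀ N lam q η) * WeightedCovering.wMeasure ω Γ ≤
            WeightedCovering.wMeasure ω (WeightedCovering.setTilde ω univ Γ q η) ∧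
          ENNReal.ofReal (WeightedCovering.xi1 l) *
              WeightedCovering.wMeasure ω (WeightedCovering.setTilde ω univ Γ q η) ≤
            WeightedCovering.wMeasure ω (WeightedCovering.setHat ω univ Γ q η l)) ∧
        -- the family of those cylinders that are contained in `C_{r,ω}`
        (WeightedCovering.wMeasure ω
            (Γ \ WeightedCovering.setTilde ω (WeightedCovering.cyl ω r 0) Γ q η) = 0 ∧
          (WeightedCovering.wMeasure ω Γ ≤
              ENNReal.ofReal q * WeightedCovering.wMeasure ω (WeightedCovering.cyl ω r 0) →
            ENNReal.ofReal (WeightedCovering.xi0 n K₀ N lam q η) * WeightedCovering.wMeasure ω Γ ≤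
              WeightedCovering.wMeasure ω
                (WeightedCovering.setTilde ω (WeightedCovering.cyl ω r 0) Γ q η)) ∧
          ENNReal.ofReal (WeightedCovering.xi1 l) *
              WeightedCovering.wMeasure ω
                (WeightedCovering.setTilde ω (WeightedCovering.cyl ω r 0) Γ q η) ≤
            WeightedCovering.wMeasure ω
              (WeightedCovering.setHat ω (WeightedCovering.cyl ω r 0) Γ q η l)) := by
  refine ⟨(WeightedCovering.decayFactor n K₀)⁻¹, WeightedCovering.decayExponent n K₀,
    inv_pos.2 (WeightedCovering.decayFactor_pos hK₀), WeightedCovering.decayExponent_pos hK₀, ?_⟩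
  intro ω hω hK r hr Γ hΓ hΓr q η l hq hη hl
  have hΓfin : WeightedCovering.wMeasure ω Γ ≠ ∞ :=
    ((measure_mono hΓr).trans_lt (WeightedCovering.wMeasure_cyl_lt_top hω r 0)).ne
  refine ⟨⟨?_, ?_, ?_⟩, ?_, ?_, ?_⟩
  · exact WeightedCovering.wMeasure_diff_setTilde hn hK₀ hω hK isOpen_univ hΓ (subset_univ _)
      hΓfin hq hη.1
  -- The unrestricted family contains the one confined to `C_{R,ω}`, where `R` is so large that the
  -- smallness hypothesis holds automatically.
  · obtain ⟨R, hrR, hR⟩ := WeightedCovering.exists_large_cyl hn hω r hΓfin hq.1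
    refine (WeightedCovering.xi0_mul_le hn hK₀ hω hK hΓ
      (hΓr.trans (WeightedCovering.cyl_zero_mono hn hω hr hrR)) hq hη hR).trans ?_
    exact measure_mono (WeightedCovering.setTilde_mono (subset_univ _) Γ q η)
  · exact WeightedCovering.xi1_mul_setTilde_le hn hω _ Γ q η hl
  · exact WeightedCovering.wMeasure_diff_setTilde hn hK₀ hω hK (WeightedCovering.isOpen_cyl r 0) hΓ
      hΓr hΓfin hq hη.1
  · exact WeightedCovering.xi0_mul_le hn hK₀ hω hK hΓ hΓr hq hη
  · exact WeightedCovering.xi1_mul_setTilde_le hn hω _ Γ q η hl
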